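/- Let $n\ge m\ge 3$ be integers and let $G\subset\{0,1,\dots,n-1\}\times\{0,1,\dots,m-1\}$ have at least two elements. Assume that $$\max\{|i_1-i_2|,|j_1-j_2|\}\ge 2$$ for every pair of distinct elements $(i_1,j_1),(i_2,j_2)$ of $G$. For $(i,j)\in G$ let $f_{ij}(x,y)=\left(\frac{x+i}{n},\frac{y+j}{m}\right)$ on $\mathbb{R}^2$, and let $E$ be the Bedford–McMullen carpet, that is, the unique non-empty compact set with $E=\bigcup_{(i,j)\in G}f_{ij}(E)$. Let $(p_{ij})_{(i,j)\in G}$ be a probability vector with $p_{ij}>0$ for all $(i,j)\in G$, and let $\mu$ be the associated self-affine measure, that is, the unique Borel probability measure supported on $E$ with $\mu=\sum_{(i,j)\in G}p_{ij}\,\mu\circ f_{ij}^{-1}$. Put $G_y=\{j:(i,j)\in G\text{ for some }i\}$, $q_j=\sum_{i:(i,j)\in G}p_{ij}$ for $j\in G_y$, $\vartheta=\frac{\log m}{\log n}$ and $$s_0=-\frac{1}{\log m}\Big(\vartheta\sum_{(i,j)\in G}p_{ij}\log p_{ij}+(1-\vartheta)\sum_{j\in G_y}q_j\log q_j\Big).$$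 For $k\ge1$ let $$e_{k,0}(\mu)=\inf\Big\{\exp\Big(\int\log d(x,\alpha)\,d\mu(x)\Big):\alpha\subset\mathbb{R}^2,\ 1\le\operatorname{card}(\alpha)\le k\Big\}$$ be the $k$th geometric mean error of $\mu$, where $d(x,\alpha)$ is the Euclidean distance from $x$ to $\alpha$. Then the lower and upper $s_0$-dimensional quantization coefficients of order zero of $\mu$, $$\underline{Q}_0^{s_0}(\mu)=\liminf_{k\to\infty}k^{1/s_0}e_{k,0}(\mu),\qquad \overline{Q}_0^{s_0}(\mu)=\limsup_{k\to\infty}k^{1/s_0}e_{k,0}(\mu),$$ satisfy $0<\underline{Q}_0^{s_0}(\mu)\le\overline{Q}_0^{s_0}(\mu)<\infty$. Moreover $e_{k,0}(\mu)\asymp k^{-1/s_0}$: there are constants $c,C>0$ such that $c\,k^{-1/s_0}\le e_{k,0}(\mu)\le C\,k^{-1/s_0}$ for all $k\ge1$. -/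

import Mathlib

open MeasureTheory Filter Topology
open scoped ENNReal

namespace BMCarpet

/-! ### Quantization of order zero -/

section Quantization

variable {X : Type*} [PseudoEMetricSpace X] [MeasurableSpace X]

/-- The integral `∫ log d(x, α) dν(x)` as an extended real number: the integral of the positive part
of `log d(x, α)` minus the integral of the negative part, where `log 0 = -∞`. (It is used for measures
for which the positive part has a finite integral, such as those with bounded support, so that the
difference is never of the form `∞ - ∞`.) -/
noncomputable def logDistIntegral (ν : Measure X) (α : Set X) : EReal :=
  ((∫⁻ x, (ENNReal.log (Metric.infEDist x α)).toENNReal ∂ν : ℝ≥0∞) : EReal) -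
    ((∫⁻ x, (-ENNReal.log (Metric.infEDist x α)).toENNReal ∂ν : ℝ≥0∞) : EReal)

/-- The `k`th geometric mean error (quantization error of order zero) of `ν`: the infimum of
`exp (∫ log d(x, α) dν(x))` over the sets `α` with `1 ≤ card α ≤ k`. -/
noncomputable def geometricMeanError (ν : Measure X) (k : ℕ) : ℝ≥0∞ :=
  ⨅ α ∈ {α : Finset X | 1 ≤ α.card ∧ α.card ≤ k}, EReal.exp (logDistIntegral ν (α : Set X))

/-- The `s`-dimensional upper quantization coefficient of order zero. -/
noncomputable def upperQuantizationCoeff (s : ℝ) (ν : Measure X) : ℝ≥0∞ :=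
  limsup (fun k : ℕ => (k : ℝ≥0∞) ^ (1 / s) * geometricMeanError ν k) atTop

/-- The `s`-dimensional lower quantization coefficient of order zero. -/
noncomputable def lowerQuantizationCoeff (s : ℝ) (ν : Measure X) : ℝ≥0∞ :=
  liminf (fun k : ℕ => (k : ℝ≥0∞) ^ (1 / s) * geometricMeanError ν k) atTop

end Quantization

/-! ### Bedford–McMullen carpets and self-affine measures -/

/-- The Euclidean plane. -/
abbrev Plane : Type := EuclideanSpace ℝ (Fin 2)

/-- The affine map `f_{ij} : (x, y) ↦ ((x + i) / n, (y + j) / m)`, with `a = (i, j)`. -/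
noncomputable def affMap (n m : ℕ) (a : ℕ × ℕ) (z : Plane) : Plane :=
  !₂[(z 0 + a.1) / n, (z 1 + a.2) / m]

/-- `E` is the self-affine set (Bedford–McMullen carpet) associated with `(f_{ij})_{(i,j) ∈ G}`. -/
structure IsCarpet (n m : ℕ) (G : Finset (ℕ × ℕ)) (E : Set Plane) : Prop where
  nonempty : E.Nonempty
  isCompact : IsCompact E
  eq_iUnion : E = ⋃ a ∈ G, affMap n m a '' E

/-- `μ` is the self-affine measure on the carpet `E` associated with `(f_{ij})_{(i,j) ∈ G}` and
`(p_{ij})_{(i,j) ∈ G}`: a Borel probability measure, supported on `E`, with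
`μ = ∑ p_{ij} μ ∘ f_{ij}⁻¹`. -/
structure IsSelfAffineMeasure (n m : ℕ) (G : Finset (ℕ × ℕ)) (p : ℕ × ℕ → ℝ) (E : Set Plane)
    (μ : Measure Plane) : Prop where
  isCarpet : IsCarpet n m G E
  isProbabilityMeasure : IsProbabilityMeasure μ
  measure_compl : μ Eᶜ = 0
  eq_sum : μ = ∑ a ∈ G, ENNReal.ofReal (p a) • μ.map (affMap n m a)

/-- `q_j`, the sum of the `p_{ij}` over the `i` with `(i, j) ∈ G`. -/
noncomputable def rowWeight (G : Finset (ℕ × ℕ)) (p : ℕ × ℕ → ℝ) (j : ℕ) : ℝ :=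
  ∑ a ∈ G with a.2 = j, p a

/-- The number `s₀ = -(1 / log m) (ϑ ∑ p_{ij} log p_{ij} + (1 - ϑ) ∑ q_j log q_j)`, where
`ϑ = log m / log n` and `j` runs over the projection of `G` to the second coordinate. -/
noncomputable def dimS (n m : ℕ) (G : Finset (ℕ × ℕ)) (p : ℕ × ℕ → ℝ) : ℝ :=
  -(1 / Real.log m) *
    (Real.log m / Real.log n * ∑ a ∈ G, p a * Real.log (p a) +
      (1 - Real.log m / Real.log n) *
        ∑ j ∈ G.image Prod.snd, rowWeight G p j * Real.log (rowWeight G p j))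

/-! ### The carpet and the self-affine measure exist -/

/-- The coding map from infinite words over `G` to the plane. -/
noncomputable def coding (n m : ℕ) (G : Finset (ℕ × ℕ)) (w : ℕ → G) : Plane :=
  !₂[∑' k, ((w k).1.1 : ℝ) * (1 / n : ℝ) ^ (k + 1), ∑' k, ((w k).1.2 : ℝ) * (1 / m : ℝ) ^ (k + 1)]

/-- Putting a letter in front of an infinite word. -/
def consWord {A : Type*} (a : A) (w : ℕ → A) : ℕ → A
  | 0 => a
  | k + 1 => w k

theorem summable_word {A : Type*} [Finite A] (d : A → ℝ) {b : ℕ} (hb : 2 ≤ b) :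
    ∃ u : ℕ → ℝ, Summable u ∧ ∀ (k : ℕ) (w : ℕ → A), ‖d (w k) * (1 / b : ℝ) ^ (k + 1)‖ ≤ u k := by
  obtain ⟨C, hC⟩ := (Set.finite_range fun a => |d a|).bddAbove
  have hb' : (2 : ℝ) ≤ b := by exact_mod_cast hb
  have h0 : (0 : ℝ) ≤ 1 / b := by positivity
  have h1 : (1 / b : ℝ) < 1 := by
    rw [div_lt_one (by linarith)]; linarith
  refine ⟨fun k => C * (1 / b : ℝ) ^ (k + 1),
    ((summable_nat_add_iff 1).2 (summable_geometric_of_lt_one h0 h1)).mul_left C, ?_⟩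
  intro k w
  rw [norm_mul, Real.norm_eq_abs, Real.norm_eq_abs, abs_of_nonneg (pow_nonneg h0 _)]
  exact mul_le_mul_of_nonneg_right (hC ⟨w k, rfl⟩) (pow_nonneg h0 _)

theorem tsum_consWord {A : Type*} [Finite A] (d : A → ℝ) {b : ℕ} (hb : 2 ≤ b) (a : A) (w : ℕ → A) :
    ∑' k, d (consWord a w k) * (1 / b : ℝ) ^ (k + 1) =
      ((∑' k, d (w k) * (1 / b : ℝ) ^ (k + 1)) + d a) / b := by
  obtain ⟨u, hu, hle⟩ := summable_word d hb
  have hs : ∀ w : ℕ → A, Summable fun k => d (w k) * (1 / b : ℝ) ^ (k + 1) := fun w =>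
    Summable.of_norm_bounded hu fun k => hle k w
  rw [(hs _).tsum_eq_zero_add, add_div, ← tsum_div_const, add_comm]
  simp only [consWord]
  congr 1
  · refine tsum_congr fun k => ?_
    rw [pow_succ (n := k + 1)]; ring
  · ring

theorem continuous_coding {n m : ℕ} (hn : 2 ≤ n) (hm : 2 ≤ m) (G : Finset (ℕ × ℕ)) :
    Continuous (coding n m G) := by
  obtain ⟨u, hu, hle⟩ := summable_word (fun a : G => (a.1.1 : ℝ)) hn
  obtain ⟨v, hv, hle'⟩ := summable_word (fun a : G => (a.1.2 : ℝ)) hm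
  refine (PiLp.continuous_toLp 2 _).comp (continuous_pi fun i => ?_)
  fin_cases i
  · refine continuous_tsum (fun k => ?_) hu hle
    exact ((continuous_of_discreteTopology (f := fun a : G => (a.1.1 : ℝ))).comp
      (continuous_apply k)).mul continuous_const
  · refine continuous_tsum (fun k => ?_) hv hle'
    exact ((continuous_of_discreteTopology (f := fun a : G => (a.1.2 : ℝ))).comp
      (continuous_apply k)).mul continuous_const

theorem coding_consWord {n m : ℕ} (hn : 2 ≤ n) (hm : 2 ≤ m) (G : Finset (ℕ × ℕ)) (a : G)
    (w : ℕ → G) : coding n m G (consWord a w) = affMap n m a.1 (coding n m G w) := by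
  have h1 := tsum_consWord (fun a : G => (a.1.1 : ℝ)) hn a w
  have h2 := tsum_consWord (fun a : G => (a.1.2 : ℝ)) hm a w
  simp only [coding, affMap, h1, h2]
  simp

theorem isCarpet_range_coding {n m : ℕ} (hn : 2 ≤ n) (hm : 2 ≤ m) {G : Finset (ℕ × ℕ)}
    (hG : G.Nonempty) : IsCarpet n m G (Set.range (coding n m G)) := by
  have : Nonempty G := hG.to_subtype
  refine ⟨Set.range_nonempty _, isCompact_range (continuous_coding hn hm G), ?_⟩
  ext z
  simp only [Set.mem_iUnion, Set.mem_image, Set.mem_range]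
  constructor
  · rintro ⟨w, rfl⟩
    refine ⟨(w 0).1, (w 0).2, _, ⟨fun k => w (k + 1), rfl⟩, ?_⟩
    rw [← coding_consWord hn hm G (w 0)]
    congr 1
    funext k
    cases k <;> rfl
  · rintro ⟨a, ha, _, ⟨w, rfl⟩, rfl⟩
    exact ⟨consWord ⟨a, ha⟩ w, coding_consWord hn hm G ⟨a, ha⟩ w⟩

theorem measurable_consWord {A : Type*} [MeasurableSpace A] (a : A) :
    Measurable (consWord a : (ℕ → A) → ℕ → A) := by
  refine measurable_pi_lambda _ fun k => ?_
  cases k with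
  | zero => exact measurable_const
  | succ k => exact measurable_pi_apply k

theorem infinitePi_eq_sum_consWord {A : Type*} [Fintype A] [MeasurableSpace A]
    [MeasurableSingletonClass A] (ν : Measure A) [IsProbabilityMeasure ν] :
    Measure.infinitePi (fun _ : ℕ => ν) =
      ∑ a, ν {a} • (Measure.infinitePi (fun _ : ℕ => ν)).map (consWord a) := by
  symm
  refine Measure.eq_infinitePi _ fun s t ht => ?_
  classical
  set P := Measure.infinitePi (fun _ : ℕ => ν) with hP
  set s' : Finset ℕ := s.preimage Nat.succ Nat.succ_injective.injOn with hs'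
  set t0 : Set A := if 0 ∈ s then t 0 else Set.univ with ht0
  have hbox : MeasurableSet (Set.pi (s : Set ℕ) t) :=
    MeasurableSet.pi s.countable_toSet fun i _ => ht i
  have hpre : ∀ a, (consWord a) ⁻¹' (Set.pi (s : Set ℕ) t) =
      if a ∈ t0 then Set.pi (s' : Set ℕ) (fun k => t (k + 1)) else ∅ := by
    intro a
    ext w
    have : w ∈ (consWord a) ⁻¹' (Set.pi (s : Set ℕ) t) ↔
        a ∈ t0 ∧ ∀ k, k + 1 ∈ s → w k ∈ t (k + 1) := by
      simp only [Set.mem_preimage, Set.mem_pi, Finset.mem_coe, ht0]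
      constructor
      · intro h
        refine ⟨?_, fun k hk => h (k + 1) hk⟩
        split_ifs with h0
        · exact h 0 h0
        · trivial
      · rintro ⟨h0, h1⟩ k hk
        cases k with
        | zero => rw [if_pos hk] at h0; exact h0
        | succ k => exact h1 k hk
    rw [this]
    by_cases ha : a ∈ t0 <;> simp [ha, hs', Set.mem_pi]
  have hprod : ∏ i ∈ s, ν (t i) = ν t0 * ∏ k ∈ s', ν (t (k + 1)) := by
    have h1 : ∏ k ∈ s', ν (t (k + 1)) = ∏ i ∈ s.erase 0, ν (t i) := by
      refine Finset.prod_bij (fun k _ => k + 1) ?_ ?_ ?_ ?_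
      · intro k hk; simpa [hs'] using hk
      · intro a _ b _ h; simpa using h
      · intro b hb
        rw [Finset.mem_erase] at hb
        obtain ⟨c, rfl⟩ := Nat.exists_eq_succ_of_ne_zero hb.1
        exact ⟨c, by simpa [hs'] using hb.2, rfl⟩
      · intro k _; rfl
    rw [h1, ht0]
    by_cases h0 : 0 ∈ s
    · rw [if_pos h0, Finset.mul_prod_erase s (fun i => ν (t i)) h0]
    · rw [if_neg h0, Finset.erase_eq_of_notMem h0, measure_univ, one_mul]
  have hsum : ν t0 = ∑ a, if a ∈ t0 then ν {a} else 0 := by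
    rw [← Finset.sum_filter, sum_measure_singleton]
    congr 1
    ext a; simp
  rw [Measure.finsetSum_apply, hprod, hsum, Finset.sum_mul]
  refine Finset.sum_congr rfl fun a _ => ?_
  rw [Measure.smul_apply, Measure.map_apply (measurable_consWord a) hbox, hpre a, smul_eq_mul]
  by_cases ha : a ∈ t0
  · rw [if_pos ha, if_pos ha, hP, Measure.infinitePi_pi _ fun i _ => ht (i + 1)]
  · simp [ha]

theorem measurable_affMap (n m : ℕ) (a : ℕ × ℕ) : Measurable (affMap n m a) := by
  refine Continuous.measurable ((PiLp.continuous_toLp 2 _).comp (continuous_pi fun i => ?_))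
  fin_cases i <;> simp <;> fun_prop

/-- For all data there is a carpet with a self-affine measure on it. -/
theorem exists_isSelfAffineMeasure {n m : ℕ} (hn : 2 ≤ n) (hm : 2 ≤ m) {G : Finset (ℕ × ℕ)}
    {p : ℕ × ℕ → ℝ} (hp : ∀ a ∈ G, 0 ≤ p a) (hsum : ∑ a ∈ G, p a = 1) :
    ∃ (E : Set Plane) (μ : Measure Plane), IsSelfAffineMeasure n m G p E μ := by
  have hne : G.Nonempty := by
    by_contra h
    rw [Finset.not_nonempty_iff_eq_empty] at h
    simp [h] at hsum
  set ν : Measure G := ∑ a : G, ENNReal.ofReal (p a) • Measure.dirac a with hν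
  have hνs : ∀ a : G, ν {a} = ENNReal.ofReal (p a) := by
    intro a
    rw [hν, Measure.finsetSum_apply, Finset.sum_eq_single a]
    · simp
    · intro b _ hb; simp [hb]
    · simp
  have : IsProbabilityMeasure ν := by
    refine ⟨?_⟩
    rw [hν, Measure.finsetSum_apply]
    simp only [Measure.smul_apply, measure_univ, smul_eq_mul, mul_one]
    rw [← ENNReal.ofReal_sum_of_nonneg fun a _ => hp a.1 a.2, Finset.sum_coe_sort G p, hsum,
      ENNReal.ofReal_one]
  have hmeas : Measurable (coding n m G) := (continuous_coding hn hm G).measurable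
  have hcar := isCarpet_range_coding hn hm hne
  refine ⟨Set.range (coding n m G), (Measure.infinitePi fun _ : ℕ => ν).map (coding n m G), hcar,
    Measure.isProbabilityMeasure_map hmeas.aemeasurable, ?_, ?_⟩
  · rw [Measure.map_apply hmeas hcar.isCompact.measurableSet.compl]
    convert measure_empty (μ := Measure.infinitePi fun _ : ℕ => ν)
    ext w; simp
  · refine Measure.ext fun S hS => ?_
    rw [Measure.map_apply hmeas hS]
    conv_lhs => rw [infinitePi_eq_sum_consWord ν]
    rw [Measure.finsetSum_apply, Measure.finsetSum_apply, ← Finset.sum_coe_sort G]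
    refine Finset.sum_congr rfl fun a _ => ?_
    rw [Measure.smul_apply, Measure.smul_apply, hνs,
      Measure.map_apply (measurable_consWord a) (hmeas hS),
      Measure.map_apply (measurable_affMap n m a) hS,
      Measure.map_apply hmeas (measurable_affMap n m a hS)]
    congr 2
    ext w
    simp only [Set.mem_preimage, coding_consWord hn hm G a w]

end BMCarpet

/-! Code the carpet by words with independent letters of law `letterMeasure`; then μ is the image of
this Bernoulli measure P under `coding`. An approximate square of height `m ^ (-t)` is fixed by the
first `columnLevel n m t` letters and by the rows of the first t letters. By the chain rule p = q ·
(p / q), minus the logarithm of its mass is a sum with two clocks: a fast one adding -log q at each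
of the t rows, and a slow one adding -log (p / q) at each of the `columnLevel n m t` columns
(`wordMeasure_agree`).

Stop at the first time τ at which the mass falls below e^(-L). The stopped squares partition the
word space and have masses between e^(-L-2D) and e^(-L). A Wald identity with bounded error
(`exists_abs_sub_integral_le`), together with `columnLevel n m t` = ϑ t + O(1), gives s₀ · log m · E
τ = L + O(1) (`exists_abs_sub_dimS_mul_le`). So the mean logarithm of the size of a stopped square
is -L / s₀ + O(1).

Upper bound: for L = log k - 2D there are at most k stopped squares, and their corners form the set
α.

Lower bound: let L = log k and move the points of α onto the carpet. By `exists_logNeg_dist_le` the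
negative part of the log-distance from x to one such point is at most log m · τ(x) plus two
corrections. If the point lies in the stopped square of x, the correction is a logarithmic potential
integrated over a set of mass at most e^(-L) = 1/k, and k such terms stay bounded. If the two
squares differ only in later rows, the distance from x to the horizontal edges of its own square
enters; its logarithm has bounded mean by renewal at τ. If a letter of the column prefix differs,
separation of G puts the points at distance at least `m ^ (-τ)`, without correction. The potentials
are bounded because expansions with nonconstant digits give mass at most 3 θ^k to intervals of
radius `b ^ (-k)`. -/

namespace BMCarpet

/-! ### Bernoulli words: prepending, resampling and shifting letters -/

section Words

variable {A : Type*} [Fintype A] [MeasurableSpace A] [MeasurableSingletonClass A]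

/-- The distribution of an infinite word whose letters are independent with distribution `ν`. -/
noncomputable abbrev wordMeasure (ν : Measure A) : Measure (ℕ → A) :=
  Measure.infinitePi fun _ : ℕ => ν

/-- Deleting the first `s` letters of an infinite word. -/
def shiftWord {A : Type*} (s : ℕ) (w : ℕ → A) : ℕ → A := fun k => w (k + s)

theorem measurable_shiftWord {A : Type*} [MeasurableSpace A] (s : ℕ) :
    Measurable (shiftWord s : (ℕ → A) → ℕ → A) :=
  measurable_pi_lambda _ fun k => measurable_pi_apply (k + s)

theorem measurable_update_letter {A : Type*} [MeasurableSpace A] (h : ℕ) (b : A) :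
    Measurable fun w : ℕ → A => Function.update w h b := by
  refine measurable_pi_lambda _ fun k => ?_
  by_cases hk : k = h
  · subst hk; simp
  · simpa [Function.update_of_ne hk] using measurable_pi_apply k

theorem measurable_letter {β : Type*} [MeasurableSpace β] (f : A → β) (h : ℕ) :
    Measurable fun w : ℕ → A => f (w h) :=
  (measurable_of_finite f).comp (measurable_pi_apply h)

variable (ν : Measure A) [IsProbabilityMeasure ν]

theorem lintegral_wordMeasure_cons {f : (ℕ → A) → ℝ≥0∞} (hf : Measurable f) :
    ∫⁻ w, f w ∂wordMeasure ν = ∑ a, ν {a} * ∫⁻ w, f (consWord a w) ∂wordMeasure ν := by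
  conv_lhs => rw [wordMeasure, infinitePi_eq_sum_consWord ν]
  rw [lintegral_finsetSum_measure]
  refine Finset.sum_congr rfl fun a _ => ?_
  rw [lintegral_smul_measure, lintegral_map hf (measurable_consWord a), smul_eq_mul]

theorem integrable_of_abs_le {X : Type*} [MeasurableSpace X] {P : Measure X} [IsFiniteMeasure P]
    {f : X → ℝ} (hf : Measurable f) {C : ℝ} (hC : ∀ x, |f x| ≤ C) : Integrable f P :=
  Integrable.of_bound hf.aestronglyMeasurable C (ae_of_all _ hC)

theorem integral_wordMeasure_cons {f : (ℕ → A) → ℝ} (hf : Measurable f) {C : ℝ}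
    (hC : ∀ w, |f w| ≤ C) :
    ∫ w, f w ∂wordMeasure ν = ∑ a, ν.real {a} * ∫ w, f (consWord a w) ∂wordMeasure ν := by
  conv_lhs => rw [wordMeasure, infinitePi_eq_sum_consWord ν]
  rw [integral_finsetSum_measure]
  · refine Finset.sum_congr rfl fun a _ => ?_
    rw [integral_smul_measure, integral_map (measurable_consWord a).aemeasurable
      hf.aestronglyMeasurable, smul_eq_mul]
    rfl
  · intro a _
    refine Integrable.smul_measure ?_ (measure_ne_top _ _)
    have := Measure.isProbabilityMeasure_map (μ := wordMeasure ν)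
      (measurable_consWord a).aemeasurable
    exact integrable_of_abs_le hf hC

/-- Replacing a letter by an independent one does not change the distribution. -/
theorem integral_wordMeasure_update (h : ℕ) {f : (ℕ → A) → ℝ} (hf : Measurable f) {C : ℝ}
    (hC : ∀ w, |f w| ≤ C) :
    ∫ w, f w ∂wordMeasure ν =
      ∑ b, ν.real {b} * ∫ w, f (Function.update w h b) ∂wordMeasure ν := by
  induction h generalizing f with
  | zero =>
    rw [integral_wordMeasure_cons ν hf hC]
    refine Finset.sum_congr rfl fun b _ => ?_
    rw [integral_wordMeasure_cons ν (f := fun w => f (Function.update w 0 b))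
      (hf.comp (measurable_update_letter 0 b)) fun w => hC _]
    have : ∀ (a : A) (w : ℕ → A), Function.update (consWord a w) 0 b = consWord b w := by
      intro a w
      funext k
      cases k <;> simp [consWord]
    simp only [this, ← Finset.sum_mul]
    rw [sum_measureReal_singleton]
    simp
  | succ h ih =>
    rw [integral_wordMeasure_cons ν hf hC]
    have h1 : ∀ a b (w : ℕ → A), Function.update (consWord a w) (h + 1) b =
        consWord a (Function.update w h b) := by
      intro a b w
      funext k
      cases k with
      | zero => simp [consWord]
      | succ k => by_cases hk : k = h <;> simp [consWord, Function.update, hk]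
    have h2 : ∀ a, ∫ w, f (consWord a w) ∂wordMeasure ν = ∑ b, ν.real {b} *
        ∫ w, f (consWord a (Function.update w h b)) ∂wordMeasure ν := fun a =>
      ih (f := fun w => f (consWord a w)) (hf.comp (measurable_consWord a)) fun w => hC _
    have h3 : ∀ b, ∫ w, f (Function.update w (h + 1) b) ∂wordMeasure ν = ∑ a, ν.real {a} *
        ∫ w, f (consWord a (Function.update w h b)) ∂wordMeasure ν := fun b => by
      rw [integral_wordMeasure_cons ν (f := fun w => f (Function.update w (h + 1) b))
        (hf.comp (measurable_update_letter (h + 1) b)) fun w => hC _]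
      simp only [h1]
    simp only [h2, h3, Finset.mul_sum]
    rw [Finset.sum_comm]
    refine Finset.sum_congr rfl fun b _ => Finset.sum_congr rfl fun a _ => ?_
    ring

/-- The letters from the `s`-th on are independent of the first `s` letters. -/
theorem setLIntegral_shiftWord (s : ℕ) {C : Set (ℕ → A)} (hC : MeasurableSet C)
    (hCs : ∀ w w' : ℕ → A, (∀ h < s, w h = w' h) → w ∈ C → w' ∈ C) {F : (ℕ → A) → ℝ≥0∞}
    (hF : Measurable F) :
    ∫⁻ w in C, F (shiftWord s w) ∂wordMeasure ν = wordMeasure ν C * ∫⁻ w, F w ∂wordMeasure ν := by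
  induction s generalizing C with
  | zero =>
    rcases C.eq_empty_or_nonempty with rfl | ⟨w, hw⟩
    · simp
    · have : C = Set.univ := Set.eq_univ_of_forall fun w' => hCs w w' (by simp) hw
      subst this
      simp
      rfl
  | succ s ih =>
    have hm := fun a : A => measurable_consWord (A := A) a
    have key : ∀ F : (ℕ → A) → ℝ≥0∞, Measurable F → ∫⁻ w in C, F w ∂wordMeasure ν =
        ∑ a, ν {a} * ∫⁻ w in consWord a ⁻¹' C, F (consWord a w) ∂wordMeasure ν := by
      intro F hF
      rw [← lintegral_indicator hC, lintegral_wordMeasure_cons ν (hF.indicator hC)]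
      refine Finset.sum_congr rfl fun a _ => ?_
      rw [← lintegral_indicator (hm a hC)]
      rfl
    rw [key (fun w => F (shiftWord (s + 1) w)) (hF.comp (measurable_shiftWord _))]
    have h1 := key (fun _ => 1) measurable_const
    simp only [setLIntegral_one] at h1
    rw [h1, Finset.sum_mul]
    refine Finset.sum_congr rfl fun a _ => ?_
    rw [mul_assoc]
    congr 1
    refine ih (hm a hC) fun w w' hww hw => ?_
    refine hCs _ _ (fun h hh => ?_) hw
    cases h with
    | zero => rfl
    | succ h => exact hww h (by omega)

end Words

/-! ### First passage for sums with a fast and a slow clock -/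

section Passage

variable {A : Type*}

/-- The sum of `a` over the first `k` letters and of `b` over the first `ℓ k` letters. -/
noncomputable def partialSum (a b : A → ℝ) (ℓ : ℕ → ℕ) (k : ℕ) (w : ℕ → A) : ℝ :=
  ∑ h ∈ Finset.range k, a (w h) + ∑ h ∈ Finset.range (ℓ k), b (w h)

/-- The first time at which the partial sums exceed `L`. -/
noncomputable def firstPassage (a b : A → ℝ) (ℓ : ℕ → ℕ) (L : ℝ) (w : ℕ → A) : ℕ :=
  sInf {k | L < partialSum a b ℓ k w}

/-- The partial sums have bounded nonnegative steps and grow linearly. -/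
structure IsLinearlyGrowing (a b : A → ℝ) (ℓ : ℕ → ℕ) (D η : ℝ) (R : ℕ) : Prop where
  fst_nonneg : ∀ x, 0 ≤ a x
  snd_nonneg : ∀ x, 0 ≤ b x
  fst_le : ∀ x, a x ≤ D
  snd_le : ∀ x, b x ≤ D
  pos : 0 < η
  zero : ℓ 0 = 0
  le_succ : ∀ k, ℓ k ≤ ℓ (k + 1)
  succ_le : ∀ k, ℓ (k + 1) ≤ ℓ k + 1
  growth : ∀ k w, partialSum a b ℓ k w + η ≤ partialSum a b ℓ (k + R) w

theorem partialSum_succ (a b : A → ℝ) {ℓ : ℕ → ℕ} (h1 : ∀ k, ℓ k ≤ ℓ (k + 1))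
    (h2 : ∀ k, ℓ (k + 1) ≤ ℓ k + 1) (k : ℕ) (w : ℕ → A) :
    partialSum a b ℓ (k + 1) w = partialSum a b ℓ k w + a (w k) +
      ((ℓ (k + 1) : ℝ) - ℓ k) * b (w (ℓ k)) := by
  unfold partialSum
  rw [Finset.sum_range_succ]
  rcases (by have := h1 k; have := h2 k; omega : ℓ (k + 1) = ℓ k ∨ ℓ (k + 1) = ℓ k + 1) with h | h
  · rw [h]; ring
  · rw [h, Finset.sum_range_succ]; push_cast; ring

theorem measurable_partialSum [Finite A] [MeasurableSpace A] [MeasurableSingletonClass A]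
    (a b : A → ℝ) (ℓ : ℕ → ℕ) (k : ℕ) : Measurable (partialSum a b ℓ k) := by
  have := Fintype.ofFinite A
  exact (Finset.measurable_sum _ fun h _ => measurable_letter a h).add
    (Finset.measurable_sum _ fun h _ => measurable_letter b h)

namespace IsLinearlyGrowing

variable {a b : A → ℝ} {ℓ : ℕ → ℕ} {D η : ℝ} {R : ℕ}

theorem step_nonneg (H : IsLinearlyGrowing a b ℓ D η R) (k : ℕ) :
    0 ≤ (ℓ (k + 1) : ℝ) - ℓ k ∧ (ℓ (k + 1) : ℝ) - ℓ k ≤ 1 := by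
  have h1 : (ℓ k : ℝ) ≤ ℓ (k + 1) := by exact_mod_cast H.le_succ k
  have h2 : (ℓ (k + 1) : ℝ) ≤ ℓ k + 1 := by exact_mod_cast H.succ_le k
  constructor <;> linarith

theorem partialSum_zero (H : IsLinearlyGrowing a b ℓ D η R) (w : ℕ → A) :
    partialSum a b ℓ 0 w = 0 := by
  simp [partialSum, H.zero]

theorem monotone (H : IsLinearlyGrowing a b ℓ D η R) (w : ℕ → A) :
    Monotone fun k => partialSum a b ℓ k w := by
  refine monotone_nat_of_le_succ fun k => ?_
  rw [partialSum_succ a b H.le_succ H.succ_le]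
  have := mul_nonneg (H.step_nonneg k).1 (H.snd_nonneg (w (ℓ k)))
  linarith [H.fst_nonneg (w k)]

theorem partialSum_succ_le (H : IsLinearlyGrowing a b ℓ D η R) (k : ℕ) (w : ℕ → A) :
    partialSum a b ℓ (k + 1) w ≤ partialSum a b ℓ k w + 2 * D := by
  rw [partialSum_succ a b H.le_succ H.succ_le]
  have := mul_le_of_le_one_left (H.snd_nonneg (w (ℓ k))) (H.step_nonneg k).2
  linarith [H.fst_le (w k), H.snd_le (w (ℓ k))]

theorem growth_mul (H : IsLinearlyGrowing a b ℓ D η R) (k i : ℕ) (w : ℕ → A) :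
    partialSum a b ℓ k w + i * η ≤ partialSum a b ℓ (k + R * i) w := by
  induction i with
  | zero => simp
  | succ i ih =>
    have := H.growth (k + R * i) w
    rw [show k + R * (i + 1) = k + R * i + R by ring]
    push_cast
    linarith

theorem nonempty_passage (H : IsLinearlyGrowing a b ℓ D η R) (L : ℝ) (w : ℕ → A) :
    {k | L < partialSum a b ℓ k w}.Nonempty := by
  obtain ⟨i, hi⟩ := exists_nat_gt (L / η)
  refine ⟨0 + R * i, ?_⟩
  have := H.growth_mul 0 i w
  rw [div_lt_iff₀ H.pos] at hi
  rw [H.partialSum_zero] at this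
  simp only [Set.mem_ofPred_eq]
  linarith

theorem lt_partialSum_firstPassage (H : IsLinearlyGrowing a b ℓ D η R) (L : ℝ) (w : ℕ → A) :
    L < partialSum a b ℓ (firstPassage a b ℓ L w) w :=
  Nat.sInf_mem (H.nonempty_passage L w)

theorem lt_firstPassage_iff (H : IsLinearlyGrowing a b ℓ D η R) {L : ℝ} {w : ℕ → A} {k : ℕ} :
    k < firstPassage a b ℓ L w ↔ partialSum a b ℓ k w ≤ L := by
  constructor
  · intro h
    exact not_lt.1 (Nat.notMem_of_lt_sInf h)
  · intro h
    by_contra hk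
    have := H.monotone w (not_lt.1 hk)
    exact absurd (H.lt_partialSum_firstPassage L w) (not_lt.2 (this.trans h))

/-- Each clock adds at most `D` in one step, which bounds the overshoot; since `0 ≤ L`, the passage
has a preceding time. -/
theorem partialSum_firstPassage_le (H : IsLinearlyGrowing a b ℓ D η R) {L : ℝ} (hL : 0 ≤ L)
    (w : ℕ → A) : partialSum a b ℓ (firstPassage a b ℓ L w) w ≤ L + 2 * D := by
  have h0 : 0 < firstPassage a b ℓ L w := by
    rw [H.lt_firstPassage_iff, H.partialSum_zero]; exact hL
  obtain ⟨k, hk⟩ := Nat.exists_eq_succ_of_ne_zero h0.ne'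
  have h1 : partialSum a b ℓ k w ≤ L := H.lt_firstPassage_iff.1 (by omega)
  rw [hk]
  linarith [H.partialSum_succ_le k w]

theorem exists_firstPassage_le (H : IsLinearlyGrowing a b ℓ D η R) (L : ℝ) :
    ∃ N, ∀ w, firstPassage a b ℓ L w ≤ N := by
  obtain ⟨i, hi⟩ := exists_nat_gt (L / η)
  refine ⟨0 + R * i, fun w => Nat.sInf_le ?_⟩
  have := H.growth_mul 0 i w
  rw [div_lt_iff₀ H.pos] at hi
  rw [H.partialSum_zero] at this
  simp only [Set.mem_ofPred_eq]
  linarith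

theorem measurable_firstPassage (H : IsLinearlyGrowing a b ℓ D η R) [Finite A] [MeasurableSpace A]
    [MeasurableSingletonClass A] (L : ℝ) : Measurable (firstPassage a b ℓ L) := by
  refine measurable_of_Ioi fun k => ?_
  have : firstPassage a b ℓ L ⁻¹' Set.Ioi k = {w | partialSum a b ℓ k w ≤ L} := by
    ext w
    simp [H.lt_firstPassage_iff]
  rw [this]
  exact measurableSet_le (measurable_partialSum a b ℓ k) measurable_const

/-- The partial sums stay in a bounded window for a bounded time only. -/
theorem card_window_le (H : IsLinearlyGrowing a b ℓ D η R) (u v : ℝ) (i : ℕ) (hi : v - u < i * η)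
    (N : ℕ) (w : ℕ → A) :
    ((Finset.range N).filter fun k => partialSum a b ℓ k w ∈ Set.Icc u v).card ≤ R * i := by
  set s := (Finset.range N).filter fun k => partialSum a b ℓ k w ∈ Set.Icc u v with hs
  rcases s.eq_empty_or_nonempty with h | h
  · simp [h]
  -- By `R * i` steps after the first visit the sum has grown by more than the length of the window.
  have hsub : s ⊆ Finset.Ico (s.min' h) (s.min' h + R * i) := by
    intro k hk
    rw [Finset.mem_Ico]
    refine ⟨s.min'_le k hk, ?_⟩
    by_contra hk'
    have h1 := H.monotone w (not_lt.1 hk')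
    have h2 := H.growth_mul (s.min' h) i w
    have h3 := (Finset.mem_filter.1 (s.min'_mem h)).2.1
    have h4 := (Finset.mem_filter.1 hk).2.2
    simp only at h1
    linarith
  simpa using Finset.card_le_card hsub

/-- A letter occurs at most once in each of the two sums, with values in `[0, D]`. -/
theorem abs_partialSum_update_sub_le (H : IsLinearlyGrowing a b ℓ D η R) (k h : ℕ) (w : ℕ → A)
    (c : A) : |partialSum a b ℓ k (Function.update w h c) - partialSum a b ℓ k w| ≤ 2 * D := by
  have key : ∀ (f : A → ℝ), (∀ x, 0 ≤ f x) → (∀ x, f x ≤ D) → ∀ n : ℕ,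
      |∑ i ∈ Finset.range n, f (Function.update w h c i) - ∑ i ∈ Finset.range n, f (w i)| ≤ D := by
    intro f hf0 hf n
    have hD : 0 ≤ D := (hf0 c).trans (hf c)
    rw [← Finset.sum_sub_distrib]
    have h0 : ∀ i, i ≠ h → f (Function.update w h c i) - f (w i) = 0 := by
      intro i hi; simp [Function.update_of_ne hi]
    by_cases hn : h ∈ Finset.range n
    · rw [Finset.sum_eq_single_of_mem h hn fun i _ hi => h0 i hi]
      rw [Function.update_self, abs_le]
      constructor <;> linarith [hf0 c, hf c, hf0 (w h), hf (w h)]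
    · rw [Finset.sum_eq_zero fun i hi => h0 i fun hh => hn (hh ▸ hi)]
      simpa using hD
  have h1 := abs_le.1 (key a H.fst_nonneg H.fst_le k)
  have h2 := abs_le.1 (key b H.snd_nonneg H.snd_le (ℓ k))
  unfold partialSum
  rw [abs_le]
  constructor <;> linarith [h1.1, h1.2, h2.1, h2.2]

section Expectation

variable [Fintype A] [MeasurableSpace A] [MeasurableSingletonClass A]
  (ν : Measure A) [IsProbabilityMeasure ν]

/-- Letter `h` may already have entered the partial sum, so the event and the centred variable need
not be independent and no martingale argument applies. Resampling letter `h` repairs this: the event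
changes only if the sum is within `2 * D` of `L`. -/
theorem abs_integral_indicator_mul_le (H : IsLinearlyGrowing a b ℓ D η R) (L : ℝ) (k h : ℕ)
    {u : A → ℝ} (hu : ∀ x, |u x| ≤ D) (hu0 : ∑ x, ν.real {x} * u x = 0) :
    |∫ w, {w | partialSum a b ℓ k w ≤ L}.indicator (fun w => u (w h)) w ∂wordMeasure ν| ≤
      D * (wordMeasure ν).real {w | partialSum a b ℓ k w ∈ Set.Icc (L - 2 * D) (L + 2 * D)} := by
  set P := wordMeasure ν
  set S := partialSum a b ℓ k with hS
  have hSm : Measurable S := measurable_partialSum a b ℓ k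
  set B := {w | S w ∈ Set.Icc (L - 2 * D) (L + 2 * D)} with hB
  have hBm : MeasurableSet B := hSm measurableSet_Icc
  have hAm : MeasurableSet {w | S w ≤ L} := measurableSet_le hSm measurable_const
  set I : (ℕ → A) → ℝ := {w | S w ≤ L}.indicator fun _ => (1 : ℝ) with hI
  have hIm : Measurable I := measurable_const.indicator hAm
  have hIb : ∀ w, |I w| ≤ 1 := fun w => by
    by_cases hw : S w ≤ L <;> simp [hI, hw]
  rw [integral_wordMeasure_update ν h ((measurable_letter u h).indicator hAm) (C := D)]
  swap
  · intro w
    have := (abs_nonneg _).trans (hu (w h))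
    by_cases hw : S w ≤ L
    · simpa [Set.indicator, hw] using hu (w h)
    · simpa [hw] using this
  have e1 : ∀ c w, {w | S w ≤ L}.indicator (fun w => u (w h)) (Function.update w h c) =
      u c * I (Function.update w h c) := by
    intro c w
    by_cases hw : S (Function.update w h c) ≤ L <;> simp [hI, Set.indicator, hw]
  -- An indicator that ignores the resampled letter contributes zero; subtracting this leaves
  -- differences of indicators only.
  have e2 : ∑ c, ν.real {c} * ∫ w, u c * I w ∂P = 0 := by
    simp only [integral_const_mul, ← mul_assoc, ← Finset.sum_mul, hu0, zero_mul]
  simp only [e1]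
  rw [← sub_zero (∑ c, _), ← e2, ← Finset.sum_sub_distrib]
  have hsum : ∑ c, ν.real {c} = 1 := by rw [sum_measureReal_singleton]; simp
  calc _ ≤ ∑ c, |ν.real {c} * ∫ w, u c * I (Function.update w h c) ∂P -
          ν.real {c} * ∫ w, u c * I w ∂P| := Finset.abs_sum_le_sum_abs _ _
    _ ≤ ∑ c, ν.real {c} * (D * P.real B) := ?_
    _ = D * P.real B := by rw [← Finset.sum_mul, hsum, one_mul]
  refine Finset.sum_le_sum fun c _ => ?_
  rw [← mul_sub, abs_mul, abs_of_nonneg measureReal_nonneg]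
  refine mul_le_mul_of_nonneg_left ?_ measureReal_nonneg
  have hi1 : Integrable (fun w => u c * I (Function.update w h c)) P :=
    (integrable_of_abs_le (hIm.comp (measurable_update_letter h c)) fun w => hIb _).const_mul _
  have hi2 : Integrable (fun w => u c * I w) P := (integrable_of_abs_le hIm hIb).const_mul _
  rw [← integral_sub hi1 hi2, ← integral_indicator_one hBm, ← integral_const_mul]
  refine (abs_integral_le_integral_abs).trans (integral_mono (hi1.sub hi2).abs
    (((integrable_const (1 : ℝ)).indicator hBm).const_mul D) fun w => ?_)
  simp only
  rw [← mul_sub, abs_mul]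
  refine mul_le_mul (hu c) ?_ (abs_nonneg _) ((abs_nonneg _).trans (hu c))
  have hd := abs_le.1 (H.abs_partialSum_update_sub_le k h w c)
  -- The indicators differ only if exactly one of the two sums exceeds `L`; being at most `2 * D`
  -- apart, both are then near `L`.
  by_cases h1 : S (Function.update w h c) ≤ L <;> by_cases h2 : S w ≤ L
  · by_cases h3 : w ∈ B <;> simp [hI, Set.indicator, h1, h2, h3]
  · have h3 : w ∈ B := ⟨by rw [hS] at *; linarith, by rw [hS] at *; linarith [hd.1]⟩
    simp [hI, Set.indicator, h1, h2, h3]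
  · have h3 : w ∈ B := ⟨by rw [hS] at *; linarith [hd.2], by
      have := abs_nonneg (u c); have := hu c; linarith⟩
    simp [hI, Set.indicator, h1, h2, h3]
  · by_cases h3 : w ∈ B <;> simp [hI, Set.indicator, h1, h2, h3]

/-- A version of Wald's identity, up to a bounded error. -/
theorem exists_abs_sub_integral_le (H : IsLinearlyGrowing a b ℓ D η R) :
    ∃ C : ℝ, ∀ L : ℝ, 0 ≤ L →
      |L - (∑ x, ν.real {x} * a x) * ∫ w, (firstPassage a b ℓ L w : ℝ) ∂wordMeasure ν -
        (∑ x, ν.real {x} * b x) * ∫ w, (ℓ (firstPassage a b ℓ L w) : ℝ) ∂wordMeasure ν| ≤ C := by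
  have hsum : ∑ c, ν.real {c} = 1 := by rw [sum_measureReal_singleton]; simp
  set α := ∑ x, ν.real {x} * a x with hα
  set β := ∑ x, ν.real {x} * b x with hβ
  set P := wordMeasure ν
  have mean : ∀ f : A → ℝ, (∀ x, 0 ≤ f x) → (∀ x, f x ≤ D) →
      0 ≤ ∑ x, ν.real {x} * f x ∧ ∑ x, ν.real {x} * f x ≤ D := by
    intro f h0 h1
    refine ⟨Finset.sum_nonneg fun x _ => mul_nonneg measureReal_nonneg (h0 x), ?_⟩
    calc _ ≤ ∑ x, ν.real {x} * D := Finset.sum_le_sum fun x _ =>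
          mul_le_mul_of_nonneg_left (h1 x) measureReal_nonneg
      _ = D := by rw [← Finset.sum_mul, hsum, one_mul]
  have ha := mean a H.fst_nonneg H.fst_le
  have hb := mean b H.snd_nonneg H.snd_le
  rw [← hα] at ha
  rw [← hβ] at hb
  have hD : 0 ≤ D := ha.1.trans ha.2
  have hua : ∀ x, |a x - α| ≤ D := fun x => by
    rw [abs_le]; constructor <;> linarith [H.fst_nonneg x, H.fst_le x, ha.1, ha.2]
  have hub : ∀ x, |b x - β| ≤ D := fun x => by
    rw [abs_le]; constructor <;> linarith [H.snd_nonneg x, H.snd_le x, hb.1, hb.2]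
  have hua0 : ∑ x, ν.real {x} * (a x - α) = 0 := by
    simp only [mul_sub, Finset.sum_sub_distrib, ← Finset.sum_mul, hsum]; linarith
  have hub0 : ∑ x, ν.real {x} * (b x - β) = 0 := by
    simp only [mul_sub, Finset.sum_sub_distrib, ← Finset.sum_mul, hsum]; linarith
  -- The window around `L` has length `4 * D`, so it is visited at most `R * i` times.
  obtain ⟨i, hi⟩ := exists_nat_gt (4 * D / η)
  rw [div_lt_iff₀ H.pos] at hi
  -- Each visit to the window costs `D` for each clock; the last `2 * D` is the overshoot.
  refine ⟨2 * D * (R * i : ℕ) + 2 * D, fun L hL => ?_⟩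
  obtain ⟨N, hN⟩ := H.exists_firstPassage_le L
  set τ := firstPassage a b ℓ L with hτ
  set S := partialSum a b ℓ with hS
  set J : ℕ → Set (ℕ → A) := fun k => {w | S k w ≤ L} with hJ
  have hJm : ∀ k, MeasurableSet (J k) := fun k =>
    measurableSet_le (measurable_partialSum a b ℓ k) measurable_const
  have hτm : Measurable τ := H.measurable_firstPassage L
  set Fa : ℕ → (ℕ → A) → ℝ := fun k => (J k).indicator fun w => a (w k) - α with hFa
  set Fb : ℕ → (ℕ → A) → ℝ := fun k => (J k).indicator fun w => b (w (ℓ k)) - β with hFb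
  have hFai : ∀ k, Integrable (Fa k) P := fun k =>
    (integrable_of_abs_le (measurable_letter (fun x => a x - α) k) fun w => hua _).indicator (hJm k)
  have hFbi : ∀ k, Integrable (Fb k) P := fun k =>
    (integrable_of_abs_le (measurable_letter (fun x => b x - β) (ℓ k)) fun w => hub _).indicator
      (hJm k)
  -- Telescoping of the compensated sum. The horizon `N` is deterministic, and stopping is carried
  -- by the indicators of `J k`, the event that the passage comes after time `k`.
  have tele : ∀ w, S (τ w) w - α * τ w - β * ℓ (τ w) =
      ∑ k ∈ Finset.range N, (Fa k w + ((ℓ (k + 1) : ℝ) - ℓ k) * Fb k w) := by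
    intro w
    have h1 : ∀ k ∈ Finset.range N, Fa k w + ((ℓ (k + 1) : ℝ) - ℓ k) * Fb k w =
        if k < τ w then (S (k + 1) w - α * (k + 1 : ℕ) - β * ℓ (k + 1)) -
          (S k w - α * k - β * ℓ k) else 0 := by
      intro k _
      by_cases hk : k < τ w
      · have hk' : w ∈ J k := H.lt_firstPassage_iff.1 hk
        rw [if_pos hk, hFa, hFb]
        simp only [Set.indicator_of_mem hk']
        rw [hS, partialSum_succ a b H.le_succ H.succ_le]
        push_cast
        ring
      · have hk' : w ∉ J k := fun h => hk (H.lt_firstPassage_iff.2 h)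
        rw [if_neg hk, hFa, hFb]
        simp only [Set.indicator_of_notMem hk']
        ring
    rw [Finset.sum_congr rfl h1, ← Finset.sum_filter]
    have h2 : (Finset.range N).filter (fun k => k < τ w) = Finset.range (τ w) := by
      ext k
      have := hN w
      simp only [Finset.mem_filter, Finset.mem_range]
      omega
    rw [h2, Finset.sum_range_sub (fun k => S k w - α * k - β * ℓ k)]
    simp [hS, H.partialSum_zero, H.zero]
  have hτi : Integrable (fun w => (τ w : ℝ)) P :=
    integrable_of_abs_le (measurable_from_nat.comp hτm) (C := N) fun w => by
      rw [abs_of_nonneg (Nat.cast_nonneg _)]; exact_mod_cast hN w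
  have hℓmono : Monotone ℓ := monotone_nat_of_le_succ H.le_succ
  have hℓi : Integrable (fun w => (ℓ (τ w) : ℝ)) P :=
    integrable_of_abs_le ((measurable_from_nat (f := fun k => (ℓ k : ℝ))).comp hτm) (C := ℓ N)
      fun w => by
        rw [abs_of_nonneg (Nat.cast_nonneg _)]; exact_mod_cast hℓmono (hN w)
  set W : ℕ → Set (ℕ → A) := fun k => {w | S k w ∈ Set.Icc (L - 2 * D) (L + 2 * D)} with hW
  have hWm : ∀ k, MeasurableSet (W k) := fun k => measurable_partialSum a b ℓ k measurableSet_Icc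
  have hWsum : ∑ k ∈ Finset.range N, P.real (W k) ≤ (R * i : ℕ) := by
    have h1 : ∑ k ∈ Finset.range N, P.real (W k) =
        ∫ w, ∑ k ∈ Finset.range N, (W k).indicator 1 w ∂P := by
      have hWi : ∀ k ∈ Finset.range N, Integrable (fun w => (W k).indicator (1 : (ℕ → A) → ℝ) w) P :=
        fun k _ => (integrable_const (1 : ℝ)).indicator (hWm k)
      rw [integral_finsetSum _ hWi]
      exact Finset.sum_congr rfl fun k _ => (integral_indicator_one (hWm k)).symm
    rw [h1]
    have h2 : ∫ _w, ((R * i : ℕ) : ℝ) ∂P = (R * i : ℕ) := by simp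
    rw [← h2]
    refine integral_mono (integrable_finsetSum _ fun k _ =>
      (integrable_const (1 : ℝ)).indicator (hWm k)) (integrable_const _) fun w => ?_
    have h3 : ∑ k ∈ Finset.range N, (W k).indicator (1 : (ℕ → A) → ℝ) w =
        (((Finset.range N).filter fun k => S k w ∈ Set.Icc (L - 2 * D) (L + 2 * D)).card : ℝ) := by
      rw [Finset.card_filter]
      push_cast
      refine Finset.sum_congr rfl fun k _ => ?_
      by_cases hk : S k w ∈ Set.Icc (L - 2 * D) (L + 2 * D)
      · rw [if_pos hk, Set.indicator_of_mem (show w ∈ W k from hk)]; rfl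
      · rw [if_neg hk, Set.indicator_of_notMem (show w ∉ W k from hk)]
    simp only [h3]
    exact_mod_cast H.card_window_le _ _ i (by linarith) N w
  have main : |∫ w, (S (τ w) w - α * τ w - β * ℓ (τ w)) ∂P| ≤ 2 * D * (R * i : ℕ) := by
    simp only [tele]
    have hFi : ∀ k ∈ Finset.range N, Integrable
        (fun w => Fa k w + ((ℓ (k + 1) : ℝ) - ℓ k) * Fb k w) P := fun k _ =>
      (hFai k).add ((hFbi k).const_mul _)
    rw [integral_finsetSum _ hFi]
    refine (Finset.abs_sum_le_sum_abs _ _).trans ?_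
    calc _ ≤ ∑ k ∈ Finset.range N, 2 * D * P.real (W k) := Finset.sum_le_sum fun k _ => ?_
      _ ≤ _ := by
        rw [← Finset.mul_sum]
        exact mul_le_mul_of_nonneg_left hWsum (by linarith)
    rw [integral_add (hFai k) ((hFbi k).const_mul _), integral_const_mul]
    have h1 := H.abs_integral_indicator_mul_le ν L k k hua hua0
    have h2 := H.abs_integral_indicator_mul_le ν L k (ℓ k) hub hub0
    refine (abs_add_le _ _).trans ?_
    rw [abs_mul, abs_of_nonneg (H.step_nonneg k).1]
    have h3 := mul_le_of_le_one_left (abs_nonneg (∫ w, Fb k w ∂P)) (H.step_nonneg k).2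
    change _ + _ ≤ 2 * D * P.real (W k)
    calc _ ≤ D * P.real (W k) + D * P.real (W k) := add_le_add h1 (h3.trans h2)
      _ = _ := by ring
  have hSi : Integrable (fun w => S (τ w) w) P := by
    have : Integrable (fun w => (S (τ w) w - α * τ w - β * ℓ (τ w)) + (α * τ w + β * ℓ (τ w))) P := by
      refine Integrable.add ?_ ((hτi.const_mul α).add (hℓi.const_mul β))
      simp only [tele]
      exact integrable_finsetSum _ fun k _ => (hFai k).add ((hFbi k).const_mul _)
    refine this.congr (ae_of_all _ fun w => ?_)
    simp only
    ring
  have hSτi : Integrable (fun w => S (τ w) w - α * τ w) P := hSi.sub (hτi.const_mul α)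
  rw [integral_sub hSτi (hℓi.const_mul β),
    integral_sub hSi (hτi.const_mul α), integral_const_mul, integral_const_mul] at main
  have hS1 : L ≤ ∫ w, S (τ w) w ∂P := by
    have : ∫ _w, L ∂P = L := by simp
    rw [← this]
    exact integral_mono (integrable_const _) hSi fun w => (H.lt_partialSum_firstPassage L w).le
  have hS2 : ∫ w, S (τ w) w ∂P ≤ L + 2 * D := by
    have : ∫ _w, (L + 2 * D) ∂P = L + 2 * D := by simp
    rw [← this]
    exact integral_mono hSi (integrable_const _) fun w => H.partialSum_firstPassage_le hL w
  rw [abs_le] at main ⊢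
  constructor <;> linarith [main.1, main.2]

end Expectation

end IsLinearlyGrowing

end Passage

/-! ### Approximate squares as cylinders, and their masses -/

section Cylinder

variable {A : Type*}

/-- The first `s` letters of two words are the same, and so are the images of the first `t` letters
under `r`. -/
def Agree (r : A → ℕ) (s t : ℕ) (w w' : ℕ → A) : Prop :=
  (∀ h < s, w h = w' h) ∧ ∀ h < t, r (w h) = r (w' h)

theorem Agree.symm {r : A → ℕ} {s t : ℕ} {w w' : ℕ → A} (h : Agree r s t w w') :
    Agree r s t w' w :=
  ⟨fun i hi => (h.1 i hi).symm, fun i hi => (h.2 i hi).symm⟩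

/-- Beyond the first `ℓ k` letters a cell knows only the values of `r`, so the fast summand must
factor through `r`. -/
theorem Agree.partialSum_eq {r : A → ℕ} {a b : A → ℝ} (ha : ∀ x y, r x = r y → a x = a y)
    {ℓ : ℕ → ℕ} (hℓ : Monotone ℓ) {k j : ℕ} (hj : j ≤ k) {w w' : ℕ → A}
    (h : Agree r (ℓ k) k w w') : partialSum a b ℓ j w = partialSum a b ℓ j w' := by
  unfold partialSum
  congr 1
  · refine Finset.sum_congr rfl fun i hi => ha _ _ (h.2 i ?_)
    have := Finset.mem_range.1 hi; omega
  · refine Finset.sum_congr rfl fun i hi => ?_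
    rw [h.1 i]
    have := Finset.mem_range.1 hi; have := hℓ hj; omega

/-- The partial sums up to the passage time are functions of the stopped cell. Hence stopped cells
are equal or disjoint. -/
theorem IsLinearlyGrowing.firstPassage_eq_of_agree {r : A → ℕ} {a b : A → ℝ} {ℓ : ℕ → ℕ} {D η : ℝ}
    {R : ℕ} (H : IsLinearlyGrowing a b ℓ D η R) (ha : ∀ x y, r x = r y → a x = a y) {L : ℝ}
    {w w' : ℕ → A}
    (h : Agree r (ℓ (firstPassage a b ℓ L w)) (firstPassage a b ℓ L w) w w') :
    firstPassage a b ℓ L w' = firstPassage a b ℓ L w := by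
  have hℓ : Monotone ℓ := monotone_nat_of_le_succ H.le_succ
  refine le_antisymm ?_ ?_
  · rw [← not_lt, H.lt_firstPassage_iff, not_le, ← h.partialSum_eq ha hℓ le_rfl]
    exact H.lt_partialSum_firstPassage L w
  · by_contra hlt
    rw [not_le] at hlt
    have h1 := H.lt_partialSum_firstPassage L w'
    rw [← h.partialSum_eq ha hℓ hlt.le] at h1
    exact absurd (H.lt_firstPassage_iff.1 hlt) (not_le.2 h1)

variable [Fintype A] [MeasurableSpace A] [MeasurableSingletonClass A] (ν : Measure A)

theorem measurableSet_agree (r : A → ℕ) (s t : ℕ) (w : ℕ → A) :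
    MeasurableSet {w' | Agree r s t w w'} := by
  simp only [Agree, Set.ofPred_and, Set.ofPred_forall]
  refine MeasurableSet.inter ?_ ?_
  · exact MeasurableSet.iInter fun h => MeasurableSet.iInter fun _ =>
      (Set.toFinite {x | w h = x}).measurableSet.preimage (measurable_pi_apply h)
  · exact MeasurableSet.iInter fun h => MeasurableSet.iInter fun _ =>
      (Set.toFinite {x | r (w h) = r x}).measurableSet.preimage (measurable_pi_apply h)

/-- The information content of the image of a letter under `r`. -/
noncomputable def fiberInfo (r : A → ℕ) (x : A) : ℝ := -Real.log (ν.real {y | r y = r x})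

/-- The information content of a letter, given its image under `r`. -/
noncomputable def condInfo (r : A → ℕ) (x : A) : ℝ :=
  -Real.log (ν.real {x} / ν.real {y | r y = r x})

/-- A cell is a product set: single letters up to `ℓ k`, fibres of `r` from there to `k`. Writing
the mass of a letter as the mass of its fibre times a conditional mass splits the logarithm between
the two clocks. -/
theorem wordMeasure_agree [IsProbabilityMeasure ν] (hν : ∀ x, 0 < ν.real {x}) (r : A → ℕ)
    {ℓ : ℕ → ℕ} {k : ℕ} (hk : ℓ k ≤ k) (w : ℕ → A) :
    wordMeasure ν {w' | Agree r (ℓ k) k w w'} =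
      ENNReal.ofReal (Real.exp (-partialSum (fiberInfo ν r) (condInfo ν r) ℓ k w)) := by
  classical
  have hq : ∀ x, 0 < ν.real {y | r y = r x} := fun x =>
    (hν x).trans_le (measureReal_mono fun y hy => by
      rw [Set.mem_singleton_iff.1 hy]; exact rfl)
  have hset : {w' | Agree r (ℓ k) k w w'} = Set.pi (Finset.range k : Set ℕ)
      fun i => if i < ℓ k then {w i} else {y | r y = r (w i)} := by
    ext w'
    simp only [Agree, Set.mem_ofPred_eq, Set.mem_pi, Finset.coe_range, Set.mem_Iio]
    constructor
    · intro h i hi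
      split_ifs with h1
      · exact (h.1 i h1).symm
      · exact (h.2 i hi).symm
    · intro h
      refine ⟨fun i hi => ?_, fun i hi => ?_⟩
      · have := h i (hi.trans_le hk)
        rw [if_pos hi] at this
        exact this.symm
      · have := h i hi
        split_ifs at this with h1
        · rw [Set.mem_singleton_iff.1 this]
        · exact this.symm
  rw [hset, wordMeasure, Measure.infinitePi_pi _ fun i _ => (Set.toFinite _).measurableSet]
  have hfac : ∀ i ∈ Finset.range k, ν (if i < ℓ k then {w i} else {y | r y = r (w i)}) =
      ENNReal.ofReal (Real.exp (-fiberInfo ν r (w i)) *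
        if i < ℓ k then Real.exp (-condInfo ν r (w i)) else 1) := by
    intro i _
    have hq' := hq (w i)
    simp only [fiberInfo, condInfo, neg_neg]
    rw [Real.exp_log hq', Real.exp_log (div_pos (hν _) hq')]
    split_ifs with h1
    · rw [mul_div_cancel₀ _ hq'.ne', ofReal_measureReal]
    · rw [mul_one, ofReal_measureReal]
  rw [Finset.prod_congr rfl hfac, ← ENNReal.ofReal_prod_of_nonneg]
  swap
  · intro i _
    split_ifs <;> positivity
  rw [Finset.prod_mul_distrib, ← Finset.prod_filter]
  have h2 : (Finset.range k).filter (fun i => i < ℓ k) = Finset.range (ℓ k) := by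
    ext i
    simp only [Finset.mem_filter, Finset.mem_range]
    omega
  rw [h2, ← Real.exp_sum, ← Real.exp_sum, ← Real.exp_add, partialSum]
  congr 2
  simp only [Finset.sum_neg_distrib]
  ring

end Cylinder

/-! ### Expansions in an integer base -/

section Expansion

variable {A : Type*} {b : ℕ} {d : A → ℕ}

/-- The number with the digits `d (w k)` in base `b` after the point. -/
noncomputable def expansion (b : ℕ) (d : A → ℕ) (w : ℕ → A) : ℝ :=
  ∑' k, (d (w k) : ℝ) * (1 / b : ℝ) ^ (k + 1)

/-- The integer with the first `k` digits `d (w h)` in base `b`. -/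
def digitPrefix (b : ℕ) (d : A → ℕ) (w : ℕ → A) : ℕ → ℕ
  | 0 => 0
  | k + 1 => b * digitPrefix b d w k + d (w k)

theorem summable_expansion (hb : 2 ≤ b) (hd : ∀ x, d x < b) (w : ℕ → A) :
    Summable fun k => (d (w k) : ℝ) * (1 / b : ℝ) ^ (k + 1) := by
  have hb' : (2 : ℝ) ≤ b := by exact_mod_cast hb
  have h1 : (1 / b : ℝ) < 1 := by rw [div_lt_one (by linarith)]; linarith
  refine Summable.of_nonneg_of_le (fun k => by positivity) (fun k => ?_)
    (((summable_nat_add_iff 1).2 (summable_geometric_of_lt_one (by positivity) h1)).mul_left (b : ℝ))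
  exact mul_le_mul_of_nonneg_right (by exact_mod_cast (hd _).le) (by positivity)

theorem expansion_nonneg (w : ℕ → A) : 0 ≤ expansion b d w := tsum_nonneg fun k => by positivity

theorem expansion_le_one (hb : 2 ≤ b) (hd : ∀ x, d x < b) (w : ℕ → A) : expansion b d w ≤ 1 := by
  have hb' : (2 : ℝ) ≤ b := by exact_mod_cast hb
  have h0 : (0 : ℝ) ≤ 1 / b := by positivity
  have h1 : (1 / b : ℝ) < 1 := by rw [div_lt_one (by linarith)]; linarith
  have hs : HasSum (fun k : ℕ => ((b : ℝ) - 1) / b * (1 / b : ℝ) ^ k) 1 := by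
    have := (hasSum_geometric_of_lt_one h0 h1).mul_left (((b : ℝ) - 1) / b)
    have h2 : (b : ℝ) - 1 ≠ 0 := by linarith
    have h3 : (b : ℝ) ≠ 0 := by linarith
    rw [show 1 - 1 / (b : ℝ) = (b - 1) / b by field_simp, mul_inv_cancel₀ (div_ne_zero h2 h3)] at this
    exact this
  refine hasSum_le (fun k => ?_) (summable_expansion hb hd w).hasSum hs
  have h2 : (d (w k) : ℝ) ≤ b - 1 := by
    have : (d (w k) : ℝ) + 1 ≤ b := by exact_mod_cast hd (w k)
    linarith
  calc (d (w k) : ℝ) * (1 / b : ℝ) ^ (k + 1) ≤ (b - 1) * (1 / b : ℝ) ^ (k + 1) := by gcongr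
    _ = _ := by rw [pow_succ]; ring

theorem expansion_succ (hb : 2 ≤ b) (hd : ∀ x, d x < b) (s : ℕ) (w : ℕ → A) :
    expansion b d (shiftWord s w) = (d (w s) + expansion b d (shiftWord (s + 1) w)) / b := by
  rw [expansion, (summable_expansion hb hd _).tsum_eq_zero_add, add_div, expansion, ← tsum_div_const]
  congr 1
  · simp [shiftWord]; ring
  · refine tsum_congr fun k => ?_
    simp only [shiftWord]
    rw [pow_succ (n := k + 1), show k + 1 + s = k + (s + 1) by ring]
    ring

theorem expansion_eq (hb : 2 ≤ b) (hd : ∀ x, d x < b) (s : ℕ) (w : ℕ → A) :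
    expansion b d w = (digitPrefix b d w s + expansion b d (shiftWord s w)) / (b : ℝ) ^ s := by
  induction s with
  | zero => simp [digitPrefix]; rfl
  | succ s ih =>
    have hb' : (b : ℝ) ≠ 0 := by positivity
    rw [ih, expansion_succ hb hd, digitPrefix]
    push_cast
    field_simp
    ring

theorem digitPrefix_eq_iff (hd : ∀ x, d x < b) (w w' : ℕ → A) (k : ℕ) :
    digitPrefix b d w k = digitPrefix b d w' k ↔ ∀ h < k, d (w h) = d (w' h) := by
  induction k with
  | zero => simp [digitPrefix]
  | succ k ih =>
    simp only [digitPrefix]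
    constructor
    · intro h
      have h1 := congrArg (· % b) h
      have h2 := congrArg (· / b) h
      have hb : 0 < b := (Nat.zero_le _).trans_lt (hd (w k))
      simp only [Nat.mul_add_mod, Nat.mod_eq_of_lt (hd _)] at h1
      simp only [Nat.mul_add_div hb, Nat.div_eq_of_lt (hd _), add_zero] at h2
      intro i hi
      rcases Nat.lt_succ_iff_lt_or_eq.1 hi with hi | rfl
      · exact ih.1 h2 i hi
      · exact h1
    · intro h
      rw [ih.2 fun i hi => h i (by omega), h k (by omega)]

variable [Fintype A] [MeasurableSpace A] [MeasurableSingletonClass A]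

theorem measurable_expansion (hb : 2 ≤ b) (hd : ∀ x, d x < b) : Measurable (expansion b d) := by
  have h1 : ∀ N : ℕ, Measurable fun w : ℕ → A => ∑ k ∈ Finset.range N,
      (d (w k) : ℝ) * (1 / b : ℝ) ^ (k + 1) := fun N => Finset.measurable_sum _ fun k _ =>
    (measurable_letter (fun x => (d x : ℝ)) k).mul_const _
  have h2 : Tendsto (fun (N : ℕ) (w : ℕ → A) => ∑ k ∈ Finset.range N,
      (d (w k) : ℝ) * (1 / b : ℝ) ^ (k + 1)) atTop (𝓝 (expansion b d)) :=
    tendsto_pi_nhds.2 fun w => (summable_expansion hb hd w).hasSum.tendsto_sum_nat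
  exact measurable_of_tendsto_metrizable h1 h2

/-- The negative part of the logarithm. -/
noncomputable def logNeg (u : ℝ≥0∞) : ℝ≥0∞ := (-ENNReal.log u).toENNReal

theorem measurable_logNeg : Measurable logNeg := ENNReal.measurable_log.neg.ereal_toENNReal

theorem logNeg_anti : Antitone logNeg := fun _ _ h =>
  EReal.toENNReal_le_toENNReal (EReal.neg_le_neg_iff.2 (ENNReal.log_monotone h))

theorem logNeg_ofReal {u : ℝ} (hu : 0 < u) :
    logNeg (ENNReal.ofReal u) = ENNReal.ofReal (-Real.log u) := by
  rw [logNeg, ENNReal.log_ofReal_of_pos hu, ← EReal.coe_neg, EReal.real_coe_toENNReal]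

theorem logNeg_ofReal_mul_le {c : ℝ} (hc : 0 < c) (u : ℝ≥0∞) :
    logNeg (ENNReal.ofReal c * u) ≤ ENNReal.ofReal (-Real.log c) + logNeg u := by
  rw [logNeg, ENNReal.log_mul_add, ENNReal.log_ofReal_of_pos hc, EReal.neg_add, sub_eq_add_neg,
    ← EReal.coe_neg]
  · exact EReal.toENNReal_add_le
  · left; simp
  · left; simp

/-- Layer-cake formula on a geometric scale: `u` lies below about `-log u / log b` of the powers of
`1 / b`. For `u = 0` every indicator is one and the right side is infinite. -/
theorem logNeg_ofReal_le_tsum {b : ℕ} (hb : 2 ≤ b) {u : ℝ} (hu : 0 ≤ u) :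
    logNeg (ENNReal.ofReal u) ≤
      ENNReal.ofReal (Real.log b) * ∑' k : ℕ, if u < (1 / b : ℝ) ^ k then 1 else 0 := by
  have hb' : (2 : ℝ) ≤ b := by exact_mod_cast hb
  have hlog : 0 < Real.log b := Real.log_pos (by linarith)
  rcases hu.eq_or_lt with rfl | hu
  · have : ∀ k : ℕ, (0 : ℝ) < (1 / b : ℝ) ^ k := fun k => by positivity
    simp only [this, if_true]
    rw [ENNReal.tsum_const_eq_top_of_ne_zero one_ne_zero, ENNReal.mul_top]
    · exact le_top
    · simpa using hlog
  rw [logNeg_ofReal hu]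
  set K := ⌈-Real.log u / Real.log b⌉₊ with hK
  have h1 : ∀ k ∈ Finset.range K, (if u < (1 / b : ℝ) ^ k then 1 else 0 : ℝ≥0∞) = 1 := by
    intro k hk
    rw [Finset.mem_range, hK, Nat.lt_ceil, lt_div_iff₀ hlog] at hk
    rw [if_pos]
    rw [← Real.log_lt_log_iff hu (by positivity), Real.log_pow, one_div, Real.log_inv]
    linarith
  calc ENNReal.ofReal (-Real.log u) ≤ ENNReal.ofReal (Real.log b * K) := by
        refine ENNReal.ofReal_le_ofReal ?_
        have := Nat.le_ceil (-Real.log u / Real.log b)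
        rw [div_le_iff₀ hlog] at this
        linarith
    _ = ENNReal.ofReal (Real.log b) * ∑ k ∈ Finset.range K,
          if u < (1 / b : ℝ) ^ k then 1 else 0 := by
        rw [Finset.sum_congr rfl h1, ENNReal.ofReal_mul hlog.le]
        simp
    _ ≤ _ := mul_le_mul_right (ENNReal.sum_le_tsum _) _

/-- After scaling by `b ^ k` the remainder lies in `[0, 1]`, so the integer prefix is within one of
the floor of `b ^ k * t`. Each of these three prefixes has mass at most the `k`-th power of `θ`. -/
theorem wordMeasure_abs_expansion_sub_lt_le (ν : Measure A) [IsProbabilityMeasure ν] (hb : 2 ≤ b)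
    (hd : ∀ x, d x < b) {θ : ℝ} (hθ : ∀ x, ν.real {y | d y = d x} ≤ θ) (t : ℝ) (k : ℕ) :
    wordMeasure ν {w | |expansion b d w - t| < (1 / b : ℝ) ^ k} ≤ 3 * ENNReal.ofReal θ ^ k := by
  have hb0 : (0 : ℝ) < (b : ℝ) ^ k := by positivity
  have hfix : ∀ v : ℤ, wordMeasure ν {w | (digitPrefix b d w k : ℤ) = v} ≤
      ENNReal.ofReal θ ^ k := by
    intro v
    rcases Set.eq_empty_or_nonempty {w | (digitPrefix b d w k : ℤ) = v} with h | ⟨w0, hw0⟩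
    · rw [h]; simp
    · have hsub : {w | (digitPrefix b d w k : ℤ) = v} ⊆
          Set.pi (Finset.range k : Set ℕ) fun i => {y | d y = d (w0 i)} := by
        intro w hw
        have : digitPrefix b d w k = digitPrefix b d w0 k := by
          have h1 : (digitPrefix b d w k : ℤ) = v := hw
          have h2 : (digitPrefix b d w0 k : ℤ) = v := hw0
          omega
        intro i hi
        exact (digitPrefix_eq_iff hd w w0 k).1 this i (by simpa using hi)
      refine (measure_mono hsub).trans ?_
      rw [wordMeasure, Measure.infinitePi_pi _ fun i _ => (Set.toFinite _).measurableSet]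
      calc _ ≤ ∏ _i ∈ Finset.range k, ENNReal.ofReal θ := Finset.prod_le_prod' fun i _ => by
            rw [← ofReal_measureReal]; exact ENNReal.ofReal_le_ofReal (hθ _)
        _ = _ := by simp
  set f := ⌊(b : ℝ) ^ k * t⌋ with hf
  have hcover : {w | |expansion b d w - t| < (1 / b : ℝ) ^ k} ⊆
      ({w | (digitPrefix b d w k : ℤ) = f - 1} ∪ {w | (digitPrefix b d w k : ℤ) = f}) ∪
        {w | (digitPrefix b d w k : ℤ) = f + 1} := by
    intro w hw
    have h0 := expansion_nonneg (b := b) (d := d) (shiftWord k w)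
    have h1 := expansion_le_one hb hd (shiftWord k w)
    rw [Set.mem_ofPred_eq, expansion_eq hb hd k, one_div, inv_pow, abs_lt, ← one_div] at hw
    have h2 : (b : ℝ) ^ k * t - 1 < digitPrefix b d w k + expansion b d (shiftWord k w) := by
      have := hw.1
      rw [lt_sub_iff_add_lt, lt_div_iff₀ hb0] at this
      have e : (-(1 / (b : ℝ) ^ k) + t) * (b : ℝ) ^ k = (b : ℝ) ^ k * t - 1 := by
        field_simp; ring
      linarith
    have h3 : (digitPrefix b d w k + expansion b d (shiftWord k w) : ℝ) < (b : ℝ) ^ k * t + 1 := by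
      have := hw.2
      rw [sub_lt_iff_lt_add, div_lt_iff₀ hb0] at this
      have e : (1 / (b : ℝ) ^ k + t) * (b : ℝ) ^ k = (b : ℝ) ^ k * t + 1 := by
        field_simp; ring
      linarith
    have h4 := Int.floor_le ((b : ℝ) ^ k * t)
    have h5 := Int.lt_floor_add_one ((b : ℝ) ^ k * t)
    rw [← hf] at h4 h5
    have h6 : f - 2 < (digitPrefix b d w k : ℤ) := by
      have : ((f - 2 : ℤ) : ℝ) < ((digitPrefix b d w k : ℤ) : ℝ) := by push_cast; linarith
      exact_mod_cast this
    have h7 : (digitPrefix b d w k : ℤ) < f + 2 := by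
      have : ((digitPrefix b d w k : ℤ) : ℝ) < ((f + 2 : ℤ) : ℝ) := by push_cast; linarith
      exact_mod_cast this
    simp only [Set.mem_union, Set.mem_ofPred_eq]
    omega
  calc _ ≤ _ := measure_mono hcover
    _ ≤ (ENNReal.ofReal θ ^ k + ENNReal.ofReal θ ^ k) + ENNReal.ofReal θ ^ k :=
        (measure_union_le _ _).trans (add_le_add ((measure_union_le _ _).trans
          (add_le_add (hfix _) (hfix _))) (hfix _))
    _ = _ := by ring

/-- The distribution of an expansion with nonconstant digits has a uniformly bounded logarithmic
potential. -/
theorem exists_lintegral_logNeg_expansion_le (ν : Measure A) [IsProbabilityMeasure ν] (hb : 2 ≤ b)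
    (hd : ∀ x, d x < b) {θ : ℝ} (hθ1 : θ < 1) (hθ : ∀ x, ν.real {y | d y = d x} ≤ θ) :
    ∃ C : ℝ, 0 ≤ C ∧ ∀ t : ℝ,
      ∫⁻ w, logNeg (ENNReal.ofReal |expansion b d w - t|) ∂wordMeasure ν ≤ ENNReal.ofReal C := by
  have hne : Nonempty A := nonempty_of_isProbabilityMeasure ν
  have hθ0 : 0 ≤ θ := measureReal_nonneg.trans (hθ hne.some)
  have hfin : ENNReal.ofReal (Real.log b) * (3 * (1 - ENNReal.ofReal θ)⁻¹) ≠ ∞ := by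
    refine ENNReal.mul_ne_top ENNReal.ofReal_ne_top (ENNReal.mul_ne_top (by simp) ?_)
    rw [ENNReal.inv_ne_top]
    exact (tsub_pos_of_lt (by rwa [ENNReal.ofReal_lt_one])).ne'
  refine ⟨(ENNReal.ofReal (Real.log b) * (3 * (1 - ENNReal.ofReal θ)⁻¹)).toReal,
    ENNReal.toReal_nonneg, fun t => ?_⟩
  rw [ENNReal.ofReal_toReal hfin]
  have hm := measurable_expansion (A := A) hb hd
  have hset : ∀ k : ℕ, MeasurableSet {w | |expansion b d w - t| < (1 / b : ℝ) ^ k} := fun k =>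
    measurableSet_lt (by fun_prop) measurable_const
  -- Summing over the scales gives a geometric series of ratio `θ < 1`, whatever the point `t`.
  calc _ ≤ ∫⁻ w, ENNReal.ofReal (Real.log b) *
          ∑' k : ℕ, {w | |expansion b d w - t| < (1 / b : ℝ) ^ k}.indicator 1 w ∂wordMeasure ν := by
        refine lintegral_mono fun w => (logNeg_ofReal_le_tsum hb (abs_nonneg _)).trans_eq ?_
        congr 1
    _ = ENNReal.ofReal (Real.log b) *
          ∑' k : ℕ, wordMeasure ν {w | |expansion b d w - t| < (1 / b : ℝ) ^ k} := by
        rw [lintegral_const_mul' _ _ ENNReal.ofReal_ne_top,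
          lintegral_tsum fun k => (measurable_one.indicator (hset k)).aemeasurable]
        simp only [lintegral_indicator_one (hset _)]
    _ ≤ ENNReal.ofReal (Real.log b) * ∑' k : ℕ, 3 * ENNReal.ofReal θ ^ k := by
        refine mul_le_mul_right (ENNReal.tsum_le_tsum fun k => ?_) _
        exact wordMeasure_abs_expansion_sub_lt_le ν hb hd hθ t k
    _ = _ := by rw [ENNReal.tsum_mul_left, ENNReal.tsum_geometric]

end Expansion

/-! ### Integrability at the passage time and a criterion for linear growth -/

theorem IsLinearlyGrowing.integrable_comp_firstPassage {A : Type*} [Fintype A] [MeasurableSpace A]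
    [MeasurableSingletonClass A] {a b : A → ℝ} {ℓ : ℕ → ℕ} {D η : ℝ} {R : ℕ}
    (H : IsLinearlyGrowing a b ℓ D η R) (ν : Measure A) [IsProbabilityMeasure ν] (L : ℝ)
    (f : ℕ → ℝ) : Integrable (fun w => f (firstPassage a b ℓ L w)) (wordMeasure ν) := by
  obtain ⟨N, hN⟩ := H.exists_firstPassage_le L
  refine integrable_of_abs_le ((measurable_from_nat (f := f)).comp (H.measurable_firstPassage L))
    (C := ∑ k ∈ Finset.range (N + 1), |f k|) fun w => ?_
  exact Finset.single_le_sum (f := fun k => |f k|) (fun k _ => abs_nonneg _)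
    (Finset.mem_range.2 (Nat.lt_succ_of_le (hN w)))

/-- Within `R` steps both clocks tick at least once, so it is enough that one of the two summands
stays away from zero. -/
theorem isLinearlyGrowing_of_le {A : Type*} {a b : A → ℝ} {ℓ : ℕ → ℕ} {D η : ℝ} {R : ℕ}
    (ha : ∀ x, 0 ≤ a x) (hb : ∀ x, 0 ≤ b x) (haD : ∀ x, a x ≤ D) (hbD : ∀ x, b x ≤ D) (hη : 0 < η)
    (h0 : ℓ 0 = 0) (h1 : ∀ k, ℓ k ≤ ℓ (k + 1)) (h2 : ∀ k, ℓ (k + 1) ≤ ℓ k + 1) (hR : 1 ≤ R)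
    (hℓR : ∀ k, ℓ k + 1 ≤ ℓ (k + R)) (hab : (∀ x, η ≤ a x) ∨ ∀ x, η ≤ b x) :
    IsLinearlyGrowing a b ℓ D η R := by
  refine ⟨ha, hb, haD, hbD, hη, h0, h1, h2, fun k w => ?_⟩
  have key : ∀ f : A → ℝ, (∀ x, 0 ≤ f x) → ∀ i j : ℕ, i ≤ j →
      ∑ h ∈ Finset.range i, f (w h) ≤ ∑ h ∈ Finset.range j, f (w h) := fun f hf i j hij =>
    Finset.sum_le_sum_of_subset_of_nonneg (Finset.range_mono hij) fun _ _ _ => hf _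
  unfold partialSum
  rcases hab with h | h
  · have e1 := key a ha (k + 1) (k + R) (by omega)
    have e2 := key b hb (ℓ k) (ℓ (k + R)) (by have := hℓR k; omega)
    rw [Finset.sum_range_succ] at e1
    linarith [h (w k)]
  · have e1 := key a ha k (k + R) (by omega)
    have e2 := key b hb (ℓ k + 1) (ℓ (k + R)) (hℓR k)
    rw [Finset.sum_range_succ] at e2
    linarith [h (w (ℓ k))]

/-! ### The widths of approximate squares -/

/-- The number of subdivisions into columns after which the width of a cell is comparable to the
height after `k` subdivisions into rows. -/
def columnLevel (n m k : ℕ) : ℕ := Nat.log n (m ^ k)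

section ColumnLevel

variable {n m : ℕ}

theorem columnLevel_zero : columnLevel n m 0 = 0 := by simp [columnLevel]

theorem columnLevel_mono (hm : 0 < m) : Monotone (columnLevel n m) := fun _ _ h =>
  Nat.log_mono_right (Nat.pow_le_pow_right hm h)

theorem pow_columnLevel_le (hm : 0 < m) (k : ℕ) : n ^ columnLevel n m k ≤ m ^ k :=
  Nat.pow_log_le_self n (pow_pos hm k).ne'

theorem lt_pow_columnLevel (hn : 1 < n) (k : ℕ) : m ^ k < n ^ (columnLevel n m k + 1) :=
  Nat.lt_pow_succ_log_self hn _

theorem columnLevel_succ_le (hn : 1 < n) (hmn : m ≤ n) (k : ℕ) :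
    columnLevel n m (k + 1) ≤ columnLevel n m k + 1 := by
  refine Nat.lt_succ_iff.1 (Nat.log_lt_of_lt_pow' (Nat.succ_ne_zero _) ?_)
  calc m ^ (k + 1) = m ^ k * m := pow_succ _ _
    _ < n ^ (columnLevel n m k + 1) * n :=
      Nat.mul_lt_mul_of_lt_of_le (lt_pow_columnLevel hn k) hmn (by omega)
    _ = _ := (pow_succ _ _).symm

theorem columnLevel_le (hn : 1 < n) (hmn : m ≤ n) (k : ℕ) : columnLevel n m k ≤ k := by
  induction k with
  | zero => simp [columnLevel]
  | succ k ih => exact (columnLevel_succ_le hn hmn k).trans (by omega)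

/-- Since `n < m ^ n`, after `n` further row subdivisions there is room for one more column
subdivision. -/
theorem columnLevel_add (hn : 1 < n) (hm : 1 < m) (k : ℕ) :
    columnLevel n m k + 1 ≤ columnLevel n m (k + n) := by
  refine Nat.le_log_of_pow_le hn ?_
  rw [pow_succ, pow_add]
  exact Nat.mul_le_mul (pow_columnLevel_le (by omega) k) (Nat.lt_pow_self hm).le

theorem abs_columnLevel_sub_le (hn : 1 < n) (hm : 1 < m) (k : ℕ) :
    |(columnLevel n m k : ℝ) - Real.log m / Real.log n * k| ≤ 1 := by
  have hn' : (1 : ℝ) < n := by exact_mod_cast hn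
  have hm' : (1 : ℝ) < m := by exact_mod_cast hm
  have hlog : 0 < Real.log n := Real.log_pos hn'
  have h1 : ((n : ℝ) ^ columnLevel n m k) ≤ (m : ℝ) ^ k := by
    exact_mod_cast pow_columnLevel_le (by omega : 0 < m) k
  have h2 : (m : ℝ) ^ k ≤ (n : ℝ) ^ (columnLevel n m k + 1) := by
    exact_mod_cast (lt_pow_columnLevel hn k).le
  have h3 := Real.log_le_log (by positivity) h1
  have h4 := Real.log_le_log (by positivity) h2
  rw [Real.log_pow, Real.log_pow] at h3 h4
  push_cast at h4
  have e : Real.log m / Real.log n * k = k * Real.log m / Real.log n := by ring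
  rw [e, abs_le]
  constructor
  · rw [neg_le_sub_iff_le_add, div_le_iff₀ hlog]; exact h4
  · rw [sub_le_iff_le_add']
    have := (le_div_iff₀ hlog).2 h3
    linarith

end ColumnLevel

/-! ### The self-affine measure as an image of a Bernoulli measure -/

/-- The distribution of a letter. -/
noncomputable def letterMeasure (G : Finset (ℕ × ℕ)) (p : ℕ × ℕ → ℝ) : Measure G :=
  ∑ a : G, ENNReal.ofReal (p a) • Measure.dirac a

theorem letterMeasure_singleton (G : Finset (ℕ × ℕ)) (p : ℕ × ℕ → ℝ) (a : G) :
    letterMeasure G p {a} = ENNReal.ofReal (p a) := by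
  rw [letterMeasure, Measure.finsetSum_apply, Finset.sum_eq_single a]
  · simp
  · intro b _ hb; simp [hb]
  · simp

theorem isProbabilityMeasure_letterMeasure {G : Finset (ℕ × ℕ)} {p : ℕ × ℕ → ℝ}
    (hp : ∀ a ∈ G, 0 ≤ p a) (hsum : ∑ a ∈ G, p a = 1) :
    IsProbabilityMeasure (letterMeasure G p) := by
  refine ⟨?_⟩
  rw [letterMeasure, Measure.finsetSum_apply]
  simp only [Measure.smul_apply, measure_univ, smul_eq_mul, mul_one]
  rw [← ENNReal.ofReal_sum_of_nonneg fun a _ => hp a.1 a.2, Finset.sum_coe_sort G p, hsum,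
    ENNReal.ofReal_one]

theorem map_coding_eq_sum {n m : ℕ} (hn : 2 ≤ n) (hm : 2 ≤ m) {G : Finset (ℕ × ℕ)}
    {p : ℕ × ℕ → ℝ} [IsProbabilityMeasure (letterMeasure G p)] :
    (wordMeasure (letterMeasure G p)).map (coding n m G) =
      ∑ a ∈ G, ENNReal.ofReal (p a) •
        ((wordMeasure (letterMeasure G p)).map (coding n m G)).map (affMap n m a) := by
  have hmeas : Measurable (coding n m G) := (continuous_coding hn hm G).measurable
  refine Measure.ext fun S hS => ?_
  rw [Measure.map_apply hmeas hS]
  conv_lhs => rw [wordMeasure, infinitePi_eq_sum_consWord (letterMeasure G p)]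
  rw [Measure.finsetSum_apply, Measure.finsetSum_apply, ← Finset.sum_coe_sort G]
  refine Finset.sum_congr rfl fun a _ => ?_
  rw [Measure.smul_apply, Measure.smul_apply, letterMeasure_singleton,
    Measure.map_apply (measurable_consWord a) (hmeas hS),
    Measure.map_apply (measurable_affMap n m a) hS,
    Measure.map_apply hmeas (measurable_affMap n m a hS)]
  congr 2
  ext w
  simp only [Set.mem_preimage, coding_consWord hn hm G a w]

/-- There is at most one probability measure with the self-affinity property. -/
theorem eq_of_eq_sum_map_affMap {n m : ℕ} (hn : 2 ≤ n) (hm : 2 ≤ m) {G : Finset (ℕ × ℕ)}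
    {p : ℕ × ℕ → ℝ} (hp : ∀ a ∈ G, 0 ≤ p a) (hsum : ∑ a ∈ G, p a = 1) {μ₁ μ₂ : Measure Plane}
    [IsProbabilityMeasure μ₁] [IsProbabilityMeasure μ₂]
    (h₁ : μ₁ = ∑ a ∈ G, ENNReal.ofReal (p a) • μ₁.map (affMap n m a))
    (h₂ : μ₂ = ∑ a ∈ G, ENNReal.ofReal (p a) • μ₂.map (affMap n m a)) : μ₁ = μ₂ := by
  -- Self-affinity makes the characteristic function at `t` a trigonometric sum of modulus at most
  -- one times its value at `T t`. Iterating `T` tends to `0`, where both characteristic functions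
  -- are continuous and equal to one.
  set T : Plane → Plane := fun t => !₂[t 0 / n, t 1 / m] with hT
  have hexp : ∀ c : ℝ, ‖Complex.exp (c * Complex.I)‖ = 1 := Complex.norm_exp_ofReal_mul_I
  have hinner : ∀ (a : ℕ × ℕ) (z t : Plane), inner ℝ (affMap n m a z) t =
      (t 0 * a.1 / n + t 1 * a.2 / m) + inner ℝ z (T t) := by
    intro a z t
    simp only [PiLp.inner_apply, Fin.sum_univ_two, affMap, hT]
    simp
    ring
  have hint : ∀ (μ : Measure Plane) [IsProbabilityMeasure μ] (t : Plane),
      Integrable (fun z : Plane => Complex.exp ((inner ℝ z t : ℝ) * Complex.I)) μ := by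
    intro μ _ t
    refine Integrable.of_bound (C := 1) ?_ (ae_of_all _ fun z => (hexp _).le)
    exact Continuous.aestronglyMeasurable (by fun_prop)
  have hrec : ∀ (μ : Measure Plane) [IsProbabilityMeasure μ],
      μ = ∑ a ∈ G, ENNReal.ofReal (p a) • μ.map (affMap n m a) → ∀ t, charFun μ t =
        (∑ a ∈ G, (p a : ℂ) * Complex.exp (((t 0 * a.1 / n + t 1 * a.2 / m : ℝ) : ℂ) * Complex.I)) *
          charFun μ (T t) := by
    intro μ _ h t
    rw [charFun_apply]
    conv_lhs => rw [h]
    rw [integral_finsetSum_measure, Finset.sum_mul]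
    · refine Finset.sum_congr rfl fun a ha => ?_
      rw [integral_smul_measure, integral_map (measurable_affMap n m a).aemeasurable
        (Continuous.aestronglyMeasurable (by fun_prop)), ENNReal.toReal_ofReal (hp a ha),
        charFun_apply, mul_assoc, ← integral_const_mul, Complex.real_smul]
      congr 1
      refine integral_congr_ae (ae_of_all _ fun z => ?_)
      simp only
      rw [hinner, ← Complex.exp_add, ← add_mul, ← Complex.ofReal_add]
    · intro a _
      have := Measure.isProbabilityMeasure_map (μ := μ) (measurable_affMap n m a).aemeasurable
      exact (hint _ t).smul_measure ENNReal.ofReal_ne_top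
  refine Measure.ext_of_charFun (funext fun t => ?_)
  have hstep : ∀ t, ‖charFun μ₁ t - charFun μ₂ t‖ ≤ ‖charFun μ₁ (T t) - charFun μ₂ (T t)‖ := by
    intro t
    rw [hrec μ₁ h₁ t, hrec μ₂ h₂ t, ← mul_sub, norm_mul]
    refine mul_le_of_le_one_left (norm_nonneg _) ((norm_sum_le _ _).trans ?_)
    rw [← hsum]
    refine Finset.sum_le_sum fun a ha => ?_
    rw [norm_mul, hexp, mul_one, Complex.norm_real, Real.norm_of_nonneg (hp a ha)]
  have hiter : ∀ k : ℕ, ‖charFun μ₁ t - charFun μ₂ t‖ ≤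
      ‖charFun μ₁ (!₂[t 0 / (n : ℝ) ^ k, t 1 / (m : ℝ) ^ k] : Plane) -
        charFun μ₂ (!₂[t 0 / (n : ℝ) ^ k, t 1 / (m : ℝ) ^ k] : Plane)‖ := by
    intro k
    induction k with
    | zero =>
      have : (!₂[t 0 / (n : ℝ) ^ 0, t 1 / (m : ℝ) ^ 0] : Plane) = t := by
        ext i; fin_cases i <;> simp
      rw [this]
    | succ k ih =>
      refine ih.trans ((hstep _).trans_eq ?_)
      have : T (!₂[t 0 / (n : ℝ) ^ k, t 1 / (m : ℝ) ^ k] : Plane) =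
          !₂[t 0 / (n : ℝ) ^ (k + 1), t 1 / (m : ℝ) ^ (k + 1)] := by
        ext i; fin_cases i <;> simp [hT, pow_succ, div_div]
      rw [this]
  have hlim : Tendsto (fun k : ℕ => (!₂[t 0 / (n : ℝ) ^ k, t 1 / (m : ℝ) ^ k] : Plane)) atTop
      (𝓝 0) := by
    have hz : ∀ {b : ℕ}, 2 ≤ b → ∀ c : ℝ, Tendsto (fun k : ℕ => c / (b : ℝ) ^ k) atTop (𝓝 0) :=
      fun {b} hb c => tendsto_const_nhds.div_atTop
        (tendsto_pow_atTop_atTop_of_one_lt (by exact_mod_cast hb))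
    have h0 : (0 : Plane) = !₂[0, 0] := by ext i; fin_cases i <;> simp
    rw [h0]
    refine ((PiLp.continuous_toLp 2 _).tendsto _).comp (tendsto_pi_nhds.2 fun i => ?_)
    fin_cases i
    · exact hz hn _
    · exact hz hm _
  have hcont : Tendsto (fun k : ℕ =>
      ‖charFun μ₁ (!₂[t 0 / (n : ℝ) ^ k, t 1 / (m : ℝ) ^ k] : Plane) -
        charFun μ₂ (!₂[t 0 / (n : ℝ) ^ k, t 1 / (m : ℝ) ^ k] : Plane)‖) atTop (𝓝 0) := by
    have := (((continuous_charFun (μ := μ₁)).sub (continuous_charFun (μ := μ₂))).norm.tendsto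
      0).comp hlim
    simpa [charFun_zero, Function.comp_def] using this
  have := ge_of_tendsto' hcont hiter
  exact sub_eq_zero.1 (norm_le_zero_iff.1 this)

/-! ### Entropy and the dimension -/

/-- The hypotheses on the carpet and on the probability vector. -/
structure IsCarpetWeight (n m : ℕ) (G : Finset (ℕ × ℕ)) (p : ℕ × ℕ → ℝ) : Prop where
  three_le : 3 ≤ m
  le : m ≤ n
  subset : G ⊆ Finset.range n ×ˢ Finset.range m
  two_le_card : 2 ≤ G.card
  separated : ∀ a ∈ G, ∀ b ∈ G, a ≠ b →
      2 ≤ max |(a.1 : ℤ) - (b.1 : ℤ)| |(a.2 : ℤ) - (b.2 : ℤ)|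
  pos : ∀ a ∈ G, 0 < p a
  sum_eq : ∑ a ∈ G, p a = 1

namespace IsCarpetWeight

variable {n m : ℕ} {G : Finset (ℕ × ℕ)} {p : ℕ × ℕ → ℝ}

theorem isProbabilityMeasure (h : IsCarpetWeight n m G p) :
    IsProbabilityMeasure (letterMeasure G p) :=
  isProbabilityMeasure_letterMeasure (fun a ha => (h.pos a ha).le) h.sum_eq

theorem real_singleton (h : IsCarpetWeight n m G p) (x : G) :
    (letterMeasure G p).real {x} = p x := by
  rw [measureReal_def, letterMeasure_singleton, ENNReal.toReal_ofReal (h.pos x x.2).le]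

theorem real_fiber (h : IsCarpetWeight n m G p) (x : G) :
    (letterMeasure G p).real {y | y.1.2 = x.1.2} = rowWeight G p x.1.2 := by
  classical
  have := h.isProbabilityMeasure
  have e : {y : G | y.1.2 = x.1.2} = ((Finset.univ.filter fun y : G => y.1.2 = x.1.2 : Finset G) :
      Set G) := by ext; simp
  rw [e, ← sum_measureReal_singleton, rowWeight, Finset.sum_filter, Finset.sum_filter,
    ← Finset.sum_coe_sort G]
  exact Finset.sum_congr rfl fun y _ => by rw [h.real_singleton]

theorem exists_ne (h : IsCarpetWeight n m G p) (x : G) : ∃ y : G, y ≠ x := by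
  have : Nontrivial G := by
    rw [← Fintype.one_lt_card_iff_nontrivial, Fintype.card_coe]
    exact h.two_le_card
  exact _root_.exists_ne x

theorem real_lt_one (h : IsCarpetWeight n m G p) {s : Set G} {y : G} (hy : y ∉ s) :
    (letterMeasure G p).real s < 1 := by
  have := h.isProbabilityMeasure
  have h1 : (letterMeasure G p).real s + (letterMeasure G p).real {y} ≤ 1 := by
    rw [← measureReal_union (Set.disjoint_singleton_right.2 hy) (Set.toFinite _).measurableSet]
    exact measureReal_le_one
  rw [h.real_singleton] at h1
  linarith [h.pos y y.2]

/-- Either the carpet meets more than one row, or it is contained in a single row. -/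
theorem forall_exists_row_or (G : Finset (ℕ × ℕ)) :
    (∀ x : G, ∃ y : G, y.1.2 ≠ x.1.2) ∨ ∀ x y : G, y.1.2 = x.1.2 := by
  by_cases hr : ∀ x y : G, y.1.2 = x.1.2
  · exact Or.inr hr
  · left
    push Not at hr
    obtain ⟨u, v, huv⟩ := hr
    intro x
    by_cases hx : u.1.2 = x.1.2
    · exact ⟨v, hx ▸ huv⟩
    · exact ⟨u, hx⟩

/-- With several rows each row has mass below one, so the fast clock always gains. With a single row
the fast clock stands still, but then the conditional mass is that of the letter itself, which is
below one. -/
theorem exists_isLinearlyGrowing (h : IsCarpetWeight n m G p) :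
    ∃ D η : ℝ, IsLinearlyGrowing (fiberInfo (letterMeasure G p) fun x => x.1.2)
      (condInfo (letterMeasure G p) fun x => x.1.2) (columnLevel n m) D η n ∧
      ((∀ x, η ≤ fiberInfo (letterMeasure G p) (fun x => x.1.2) x) ∨
        ∀ x, η ≤ condInfo (letterMeasure G p) (fun x => x.1.2) x) := by
  have := h.isProbabilityMeasure
  set ν := letterMeasure G p
  set r : G → ℕ := fun x => x.1.2 with hr
  have hm := h.three_le
  have hmn := h.le
  have hpos : ∀ x, 0 < ν.real {x} := fun x => by rw [h.real_singleton]; exact h.pos x x.2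
  have hle : ∀ x, ν.real {x} ≤ ν.real {y | r y = r x} := fun x =>
    measureReal_mono fun y hy => by rw [Set.mem_singleton_iff.1 hy]; exact rfl
  have hqpos : ∀ x, 0 < ν.real {y | r y = r x} := fun x => (hpos x).trans_le (hle x)
  have ha : ∀ x, 0 ≤ fiberInfo ν r x := fun x =>
    neg_nonneg.2 (Real.log_nonpos measureReal_nonneg measureReal_le_one)
  have hb : ∀ x, 0 ≤ condInfo ν r x := fun x =>
    neg_nonneg.2 (Real.log_nonpos (div_nonneg measureReal_nonneg measureReal_nonneg)
      ((div_le_one (hqpos x)).2 (hle x)))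
  have hne : Nonempty G := nonempty_of_isProbabilityMeasure ν
  have hmin : ∀ f : G → ℝ, (∀ x, 0 < f x) → ∃ η : ℝ, 0 < η ∧ ∀ x, η ≤ f x := fun f hf => by
    obtain ⟨x0, hx0⟩ := Finite.exists_min f
    exact ⟨f x0, hf x0, hx0⟩
  have hη : ∃ η : ℝ, 0 < η ∧ ((∀ x, η ≤ fiberInfo ν r x) ∨ ∀ x, η ≤ condInfo ν r x) := by
    rcases forall_exists_row_or G with hrow | hrow
    · obtain ⟨η, h0, h1⟩ := hmin (fiberInfo ν r) fun x => by
        obtain ⟨y, hy⟩ := hrow x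
        exact neg_pos.2 (Real.log_neg (hqpos x) (h.real_lt_one (y := y) hy))
      exact ⟨η, h0, Or.inl h1⟩
    · obtain ⟨η, h0, h1⟩ := hmin (condInfo ν r) fun x => by
        obtain ⟨y, hy⟩ := h.exists_ne x
        have : {y | r y = r x} = Set.univ := Set.eq_univ_of_forall fun y => hrow x y
        rw [condInfo, this, probReal_univ, div_one]
        exact neg_pos.2 (Real.log_neg (hpos x) (h.real_lt_one (y := y) (by simpa using hy)))
      exact ⟨η, h0, Or.inr h1⟩
  obtain ⟨η, hη0, hη⟩ := hη
  refine ⟨∑ x, fiberInfo ν r x + ∑ x, condInfo ν r x, η, ?_, hη⟩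
  have hA := Finset.sum_nonneg fun x (_ : x ∈ Finset.univ) => ha x
  have hB := Finset.sum_nonneg fun x (_ : x ∈ Finset.univ) => hb x
  refine isLinearlyGrowing_of_le ha hb (fun x => ?_) (fun x => ?_) hη0 columnLevel_zero
    (fun k => columnLevel_mono (by omega) (Nat.le_succ k))
    (columnLevel_succ_le (by omega) hmn) (by omega) (columnLevel_add (by omega) (by omega)) hη
  · linarith [Finset.single_le_sum (fun x _ => ha x) (Finset.mem_univ x)]
  · linarith [Finset.single_le_sum (fun x _ => hb x) (Finset.mem_univ x)]

/-- Chain rule for entropy: the full entropy is the row entropy plus the conditional entropy, and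
the two row terms of `dimS` combine to coefficient one. -/
theorem dimS_mul_log (h : IsCarpetWeight n m G p) :
    dimS n m G p * Real.log m =
      ∑ x, (letterMeasure G p).real {x} * fiberInfo (letterMeasure G p) (fun x => x.1.2) x +
        Real.log m / Real.log n *
          ∑ x, (letterMeasure G p).real {x} * condInfo (letterMeasure G p) (fun x => x.1.2) x := by
  have := h.isProbabilityMeasure
  have hm := h.three_le
  have hlog : Real.log m ≠ 0 :=
    (Real.log_pos (by exact_mod_cast (by omega : 1 < m))).ne'
  have hp : ∀ x : G, 0 < p x := fun x => h.pos x x.2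
  have hq : ∀ x : G, 0 < rowWeight G p x.1.2 := fun x => by
    rw [← h.real_fiber, measureReal_def]
    refine ENNReal.toReal_pos (fun h0 => ?_) (measure_ne_top _ _)
    have h1 : letterMeasure G p {x} ≤ 0 := h0 ▸ measure_mono fun y hy => by
      rw [Set.mem_singleton_iff.1 hy]; exact rfl
    rw [letterMeasure_singleton, nonpos_iff_eq_zero, ENNReal.ofReal_eq_zero] at h1
    linarith [hp x]
  have hrows : ∑ j ∈ G.image Prod.snd, rowWeight G p j * Real.log (rowWeight G p j) =
      ∑ x : G, p x * Real.log (rowWeight G p x.1.2) := by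
    rw [Finset.sum_coe_sort G fun x => p x * Real.log (rowWeight G p x.2),
      ← Finset.sum_fiberwise_of_maps_to (g := Prod.snd) (t := G.image Prod.snd)
        fun x hx => Finset.mem_image_of_mem _ hx]
    refine Finset.sum_congr rfl fun j _ => ?_
    conv_lhs => rw [rowWeight, Finset.sum_mul]
    refine Finset.sum_congr rfl fun x hx => ?_
    rw [(Finset.mem_filter.1 hx).2]
    rfl
  have e1 : ∑ x, (letterMeasure G p).real {x} * fiberInfo (letterMeasure G p) (fun x => x.1.2) x =
      -∑ x : G, p x * Real.log (rowWeight G p x.1.2) := by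
    rw [← Finset.sum_neg_distrib]
    refine Finset.sum_congr rfl fun x _ => ?_
    rw [fiberInfo, h.real_fiber, h.real_singleton]
    ring
  have e2 : ∑ x, (letterMeasure G p).real {x} * condInfo (letterMeasure G p) (fun x => x.1.2) x =
      -∑ x : G, p x * Real.log (p x) + ∑ x : G, p x * Real.log (rowWeight G p x.1.2) := by
    rw [← Finset.sum_neg_distrib, ← Finset.sum_add_distrib]
    refine Finset.sum_congr rfl fun x _ => ?_
    rw [condInfo, h.real_fiber, h.real_singleton, Real.log_div (hp x).ne' (hq x).ne']
    ring
  rw [e1, e2, dimS, hrows, ← Finset.sum_coe_sort G fun x => p x * Real.log (p x)]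
  field_simp
  ring

/-- The expected height of the approximate squares of measure about `exp (-L)`. -/
theorem exists_abs_sub_dimS_mul_le (h : IsCarpetWeight n m G p) :
    0 < dimS n m G p ∧ ∃ C : ℝ, ∀ L : ℝ, 0 ≤ L →
      |L - dimS n m G p * (Real.log m * ∫ w, (firstPassage
        (fiberInfo (letterMeasure G p) fun x => x.1.2)
        (condInfo (letterMeasure G p) fun x => x.1.2) (columnLevel n m) L w : ℝ)
          ∂wordMeasure (letterMeasure G p))| ≤ C := by
  have := h.isProbabilityMeasure
  obtain ⟨D, η, H, hη⟩ := h.exists_isLinearlyGrowing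
  have hdim := h.dimS_mul_log
  obtain ⟨C, hC⟩ := H.exists_abs_sub_integral_le (letterMeasure G p)
  have hm := h.three_le
  have hmn := h.le
  have hlogm : 0 < Real.log m := Real.log_pos (by exact_mod_cast (by omega : 1 < m))
  have hlogn : 0 < Real.log n := Real.log_pos (by exact_mod_cast (by omega : 1 < n))
  set ν := letterMeasure G p
  set r : G → ℕ := fun x => x.1.2 with hr
  set P := wordMeasure ν
  set α := ∑ x, ν.real {x} * fiberInfo ν r x with hα
  set β := ∑ x, ν.real {x} * condInfo ν r x with hβ
  have hα0 : 0 ≤ α := Finset.sum_nonneg fun x _ => mul_nonneg measureReal_nonneg (H.fst_nonneg x)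
  have hβ0 : 0 ≤ β := Finset.sum_nonneg fun x _ => mul_nonneg measureReal_nonneg (H.snd_nonneg x)
  have hsum : ∑ c, ν.real {c} = 1 := by rw [sum_measureReal_singleton]; simp
  have hmean : ∀ f : G → ℝ, (∀ x, η ≤ f x) → η ≤ ∑ x, ν.real {x} * f x := fun f hf => by
    calc η = ∑ x, ν.real {x} * η := by rw [← Finset.sum_mul, hsum, one_mul]
      _ ≤ _ := Finset.sum_le_sum fun x _ => mul_le_mul_of_nonneg_left (hf x) measureReal_nonneg
  -- `C` is the error in Wald's identity and `β` the price of replacing `columnLevel` by its linear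
  -- approximation, which is off by at most one.
  refine ⟨?_, C + β, fun L hL => ?_⟩
  · refine pos_of_mul_pos_left ?_ hlogm.le
    rw [hdim]
    rcases hη with hη | hη
    · have : 0 < α := H.pos.trans_le (hmean _ hη)
      positivity
    · have : 0 < β := H.pos.trans_le (hmean _ hη)
      positivity
  · set τ := firstPassage (fiberInfo ν r) (condInfo ν r) (columnLevel n m) L
    have hi1 := H.integrable_comp_firstPassage ν L fun k => (k : ℝ)
    have hi2 := H.integrable_comp_firstPassage ν L fun k => (columnLevel n m k : ℝ)
    have h1 : |∫ w, (columnLevel n m (τ w) : ℝ) ∂P -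
        Real.log m / Real.log n * ∫ w, (τ w : ℝ) ∂P| ≤ 1 := by
      rw [← integral_const_mul, ← integral_sub hi2 (hi1.const_mul _)]
      refine abs_integral_le_integral_abs.trans ?_
      have : ∫ _w, (1 : ℝ) ∂P = 1 := by simp
      conv_rhs => rw [← this]
      exact integral_mono (hi2.sub (hi1.const_mul _)).abs (integrable_const _) fun w =>
        abs_columnLevel_sub_le (by omega) (by omega) (τ w)
    have h2 := hC L hL
    rw [← mul_assoc, hdim]
    set X := ∫ w, (τ w : ℝ) ∂P
    set Y := ∫ w, (columnLevel n m (τ w) : ℝ) ∂P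
    calc |L - (α + Real.log m / Real.log n * β) * X|
        = |(L - α * X - β * Y) + β * (Y - Real.log m / Real.log n * X)| := by congr 1; ring
      _ ≤ C + β * 1 := by
        refine (abs_add_le _ _).trans (add_le_add h2 ?_)
        rw [abs_mul, abs_of_nonneg hβ0]
        exact mul_le_mul_of_nonneg_left h1 hβ0
      _ = _ := by ring

end IsCarpetWeight

/-! ### Estimates of the logarithmic integral -/

section LogDist

theorem measurable_log_infEDist {X : Type*} [PseudoEMetricSpace X] [MeasurableSpace X]
    [OpensMeasurableSpace X] (α : Set X) :
    Measurable fun x => ENNReal.log (Metric.infEDist x α) :=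
  ENNReal.measurable_log.comp measurable_infEDist

variable {X Ω : Type*} [PseudoEMetricSpace X] [MeasurableSpace X] [OpensMeasurableSpace X]
  [MeasurableSpace Ω] {P : Measure Ω} {φ : Ω → X}

/-- One `Real.log c` bounds the positive part; the other is lost when the negative part is compared
with `f`. If the negative part is infinite, the difference is `-∞`. -/
theorem logDistIntegral_map_le [IsProbabilityMeasure P] (hφ : Measurable φ) {α : Set X}
    {f : Ω → ℝ} (hf : Integrable f P) (hf0 : ∀ w, 0 ≤ f w) {c : ℝ} (hc : 1 ≤ c)
    (h : ∀ w, ∃ z ∈ α, edist (φ w) z ≤ ENNReal.ofReal (c * Real.exp (-f w))) :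
    logDistIntegral (P.map φ) α ≤ ((2 * Real.log c - ∫ w, f w ∂P : ℝ) : EReal) := by
  have hc0 : 0 < c := by linarith
  have hlc : 0 ≤ Real.log c := Real.log_nonneg hc
  have hlog : ∀ w, ENNReal.log (Metric.infEDist (φ w) α) ≤ ((Real.log c - f w : ℝ) : EReal) := by
    intro w
    obtain ⟨z, hz, hd⟩ := h w
    refine (ENNReal.log_monotone ((Metric.infEDist_le_edist_of_mem hz).trans hd)).trans_eq ?_
    rw [ENNReal.log_ofReal_of_pos (by positivity), Real.log_mul hc0.ne' (Real.exp_ne_zero _),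
      Real.log_exp, sub_eq_add_neg]
  unfold logDistIntegral
  rw [lintegral_map (measurable_log_infEDist α).ereal_toENNReal hφ,
    lintegral_map (f := fun x => (-ENNReal.log (Metric.infEDist x α)).toENNReal)
      (measurable_logNeg.comp measurable_infEDist) hφ]
  have hpos : ∫⁻ w, (ENNReal.log (Metric.infEDist (φ w) α)).toENNReal ∂P ≤
      ENNReal.ofReal (Real.log c) := by
    calc _ ≤ ∫⁻ _w, ENNReal.ofReal (Real.log c) ∂P := lintegral_mono fun w => by
          refine (EReal.toENNReal_le_toENNReal (hlog w)).trans ?_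
          rw [EReal.real_coe_toENNReal]
          exact ENNReal.ofReal_le_ofReal (by linarith [hf0 w])
      _ = _ := by simp
  have hneg : ENNReal.ofReal (∫ w, f w ∂P) ≤
      ∫⁻ w, (-ENNReal.log (Metric.infEDist (φ w) α)).toENNReal ∂P + ENNReal.ofReal (Real.log c) := by
    rw [ofReal_integral_eq_lintegral_ofReal hf (ae_of_all _ hf0)]
    calc _ ≤ ∫⁻ w, ((-ENNReal.log (Metric.infEDist (φ w) α)).toENNReal +
            ENNReal.ofReal (Real.log c)) ∂P := lintegral_mono fun w => by
          have h1 := EReal.toENNReal_le_toENNReal (EReal.neg_le_neg_iff.2 (hlog w))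
          rw [← EReal.coe_neg, EReal.real_coe_toENNReal] at h1
          calc ENNReal.ofReal (f w) = ENNReal.ofReal (-(Real.log c - f w) + Real.log c) := by
                congr 1; ring
            _ ≤ _ := ENNReal.ofReal_add_le.trans (add_le_add h1 le_rfl)
      _ = _ := by rw [lintegral_add_right _ measurable_const]; simp
  generalize ∫⁻ w, (ENNReal.log (Metric.infEDist (φ w) α)).toENNReal ∂P = A at hpos ⊢
  generalize ∫⁻ w, (-ENNReal.log (Metric.infEDist (φ w) α)).toENNReal ∂P = B at hneg ⊢
  have hI : 0 ≤ ∫ w, f w ∂P := integral_nonneg hf0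
  have hAt : A ≠ ∞ := (hpos.trans_lt ENNReal.ofReal_lt_top).ne
  rcases eq_or_ne B ∞ with hB | hB
  · rw [hB]
    lift A to NNReal using hAt
    simp
  · lift A to NNReal using hAt
    lift B to NNReal using hB
    have h1 : (A : ℝ) ≤ Real.log c := by
      rw [ENNReal.ofReal, ENNReal.coe_le_coe] at hpos
      exact_mod_cast (NNReal.coe_le_coe.2 hpos).trans_eq (Real.coe_toNNReal _ hlc)
    have h2 : ∫ w, f w ∂P ≤ B + Real.log c := by
      rw [ENNReal.ofReal, ENNReal.ofReal, ← ENNReal.coe_add, ENNReal.coe_le_coe] at hneg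
      have := NNReal.coe_le_coe.2 hneg
      rwa [NNReal.coe_add, Real.coe_toNNReal _ hlc, Real.coe_toNNReal _ hI] at this
    have e : (((A : ℝ≥0∞) : EReal) - ((B : ℝ≥0∞) : EReal)) = (((A : ℝ) - B : ℝ) : EReal) := by
      rw [EReal.coe_sub]; rfl
    rw [e, EReal.coe_le_coe_iff]
    linarith

/-- The positive part is discarded, so only the negative part needs control. -/
theorem le_logDistIntegral_map (hφ : Measurable φ) {α : Set X} {T : ℝ} (hT : 0 ≤ T)
    (h : ∫⁻ w, logNeg (Metric.infEDist (φ w) α) ∂P ≤ ENNReal.ofReal T) :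
    ((-T : ℝ) : EReal) ≤ logDistIntegral (P.map φ) α := by
  unfold logDistIntegral
  rw [lintegral_map (f := fun x => (-ENNReal.log (Metric.infEDist x α)).toENNReal)
      (measurable_logNeg.comp measurable_infEDist) hφ]
  have h1 : ((∫⁻ w, (-ENNReal.log (Metric.infEDist (φ w) α)).toENNReal ∂P : ℝ≥0∞) : EReal) ≤
      (T : EReal) := by
    have := EReal.coe_ennreal_le_coe_ennreal_iff.2 h
    rwa [EReal.coe_ennreal_ofReal, max_eq_left hT] at this
  calc ((-T : ℝ) : EReal) = 0 - (T : EReal) := by simp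
    _ ≤ _ := EReal.sub_le_sub (EReal.coe_ennreal_nonneg _) h1

end LogDist

/-! ### Distances between points of the carpet -/

section Coding

variable {n m : ℕ} {G : Finset (ℕ × ℕ)}

theorem dist_le_abs_add_abs (z z' : Plane) : dist z z' ≤ |z 0 - z' 0| + |z 1 - z' 1| := by
  rw [EuclideanSpace.dist_eq, Fin.sum_univ_two, Real.dist_eq, Real.dist_eq, sq_abs, sq_abs]
  refine Real.sqrt_le_iff.2 ⟨by positivity, ?_⟩
  nlinarith [sq_abs (z 0 - z' 0), sq_abs (z 1 - z' 1),
    mul_nonneg (abs_nonneg (z 0 - z' 0)) (abs_nonneg (z 1 - z' 1))]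

theorem abs_sub_le_dist (z z' : Plane) (i : Fin 2) : |z i - z' i| ≤ dist z z' := by
  rw [dist_eq_norm, ← PiLp.sub_apply, ← Real.norm_eq_abs]
  exact PiLp.norm_apply_le _ i

/-- The remainders after digit `h` lie in `[0, 1]` and can cancel at most one unit of a digit gap of
two. -/
theorem one_div_pow_le_abs_expansion_sub {A : Type*} {b : ℕ} {d : A → ℕ} (hb : 2 ≤ b)
    (hd : ∀ x, d x < b) {w w' : ℕ → A} {h : ℕ} (hw : ∀ i < h, d (w i) = d (w' i))
    (h2 : 2 ≤ |(d (w h) : ℤ) - d (w' h)|) :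
    1 / (b : ℝ) ^ (h + 1) ≤ |expansion b d w - expansion b d w'| := by
  have hb0 : (0 : ℝ) < (b : ℝ) ^ (h + 1) := by positivity
  rw [expansion_eq hb hd (h + 1) w, expansion_eq hb hd (h + 1) w', ← sub_div, abs_div,
    abs_of_pos hb0]
  refine div_le_div_of_nonneg_right ?_ hb0.le
  simp only [digitPrefix, (digitPrefix_eq_iff hd w w' h).2 hw]
  have e0 := expansion_nonneg (b := b) (d := d) (shiftWord (h + 1) w)
  have e1 := expansion_le_one hb hd (shiftWord (h + 1) w)
  have e2 := expansion_nonneg (b := b) (d := d) (shiftWord (h + 1) w')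
  have e3 := expansion_le_one hb hd (shiftWord (h + 1) w')
  have h2' : (2 : ℝ) ≤ |(d (w h) : ℝ) - d (w' h)| := by exact_mod_cast h2
  push_cast
  rw [le_abs] at h2' ⊢
  rcases h2' with h2' | h2'
  · left; linarith
  · right; linarith

/-- Different prefixes mean `b`-adic intervals with disjoint interiors, so the way to the other
point passes an endpoint of the first interval. Adjacent digits permit no uniform gap, hence this
weaker bound. -/
theorem min_div_pow_le_abs_expansion_sub {A : Type*} {b : ℕ} {d : A → ℕ} (hb : 2 ≤ b)
    (hd : ∀ x, d x < b) {w w' : ℕ → A} {t : ℕ} (hw : ∃ i < t, d (w i) ≠ d (w' i)) :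
    1 / (b : ℝ) ^ t * min (expansion b d (shiftWord t w)) (1 - expansion b d (shiftWord t w)) ≤
      |expansion b d w - expansion b d w'| := by
  have hb0 : (0 : ℝ) < (b : ℝ) ^ t := by positivity
  rw [expansion_eq hb hd t w, expansion_eq hb hd t w', ← sub_div, abs_div, abs_of_pos hb0,
    one_div_mul_eq_div]
  refine div_le_div_of_nonneg_right ?_ hb0.le
  have e2 := expansion_nonneg (b := b) (d := d) (shiftWord t w')
  have e3 := expansion_le_one hb hd (shiftWord t w')
  have hne : digitPrefix b d w t ≠ digitPrefix b d w' t := by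
    rw [Ne, digitPrefix_eq_iff hd]
    push Not
    exact hw
  rcases lt_or_gt_of_ne hne with hlt | hlt
  · have : (digitPrefix b d w t : ℝ) + 1 ≤ digitPrefix b d w' t := by exact_mod_cast hlt
    refine (min_le_right _ _).trans ((?_ : _ ≤ _).trans (neg_le_abs _))
    linarith
  · have : (digitPrefix b d w' t : ℝ) + 1 ≤ digitPrefix b d w t := by exact_mod_cast hlt
    refine (min_le_left _ _).trans ((?_ : _ ≤ _).trans (le_abs_self _))
    linarith

theorem abs_expansion_sub_eq {A : Type*} {b : ℕ} {d : A → ℕ} (hb : 2 ≤ b) (hd : ∀ x, d x < b)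
    {w w' : ℕ → A} {t : ℕ} (hw : ∀ i < t, d (w i) = d (w' i)) :
    |expansion b d w - expansion b d w'| =
      1 / (b : ℝ) ^ t * |expansion b d (shiftWord t w) - expansion b d (shiftWord t w')| := by
  have hb0 : (0 : ℝ) < (b : ℝ) ^ t := by positivity
  rw [expansion_eq hb hd t w, expansion_eq hb hd t w', (digitPrefix_eq_iff hd w w' t).2 hw,
    ← sub_div, abs_div, abs_of_pos hb0, one_div_mul_eq_div]
  congr 2
  ring

theorem one_div_pow_le_one_div_pow_columnLevel (hn : 0 < n) (hm : 0 < m) (t : ℕ) :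
    1 / (m : ℝ) ^ t ≤ 1 / (n : ℝ) ^ columnLevel n m t :=
  one_div_le_one_div_of_le (by positivity) (by exact_mod_cast pow_columnLevel_le hm t)

namespace IsCarpetWeight

variable {p : ℕ × ℕ → ℝ}

theorem fst_lt (h : IsCarpetWeight n m G p) (x : G) : x.1.1 < n :=
  Finset.mem_range.1 (Finset.mem_product.1 (h.subset x.2)).1

theorem snd_lt (h : IsCarpetWeight n m G p) (x : G) : x.1.2 < m :=
  Finset.mem_range.1 (Finset.mem_product.1 (h.subset x.2)).2

theorem measurable_coding (h : IsCarpetWeight n m G p) : Measurable (coding n m G) :=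
  (continuous_coding (by have := h.three_le; have := h.le; omega)
    (by have := h.three_le; omega) G).measurable

/-- Approximate squares whose first columns differ are far apart. -/
theorem one_div_pow_le_dist_coding (h : IsCarpetWeight n m G p) {w w' : ℕ → G} {t : ℕ}
    (hw : ∃ i < columnLevel n m t, w i ≠ w' i) :
    1 / (m : ℝ) ^ t ≤ dist (coding n m G w) (coding n m G w') := by
  classical
  have hm := h.three_le
  have hmn := h.le
  have hn0 : (0 : ℝ) < n := by exact_mod_cast (by omega : 0 < n)
  have hm0 : (0 : ℝ) < m := by exact_mod_cast (by omega : 0 < m)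
  set i := Nat.find hw with hi
  obtain ⟨hit, hne⟩ := Nat.find_spec hw
  rw [← hi] at hit hne
  have hprev : ∀ j < i, w j = w' j := fun j hj => by
    by_contra hcon
    exact Nat.find_min hw hj ⟨hj.trans hit, hcon⟩
  -- At the first differing letter one coordinate jumps by at least two. A column jump is seen at
  -- scale `n ^ (-(i + 1))`, a row jump at `m ^ (-(i + 1))`, and both are at least `m ^ (-t)`.
  have hsep := h.separated (w i).1 (w i).2 (w' i).1 (w' i).2 fun e => hne (Subtype.ext e)
  rcases le_max_iff.1 hsep with hsep | hsep
  · have h1 := one_div_pow_le_abs_expansion_sub (b := n) (d := fun x : G => x.1.1) (by omega)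
      h.fst_lt (fun j hj => by rw [hprev j hj]) hsep
    calc 1 / (m : ℝ) ^ t ≤ 1 / (n : ℝ) ^ columnLevel n m t :=
          one_div_pow_le_one_div_pow_columnLevel (by omega) (by omega) t
      _ ≤ 1 / (n : ℝ) ^ (i + 1) := one_div_le_one_div_of_le (by positivity)
          (pow_le_pow_right₀ (by exact_mod_cast (by omega : 1 ≤ n)) hit)
      _ ≤ _ := h1.trans (abs_sub_le_dist (coding n m G w) (coding n m G w') 0)
  · have h1 := one_div_pow_le_abs_expansion_sub (b := m) (d := fun x : G => x.1.2) (by omega)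
      h.snd_lt (fun j hj => by rw [hprev j hj]) hsep
    have := columnLevel_le (by omega : 1 < n) hmn t
    calc 1 / (m : ℝ) ^ t ≤ 1 / (m : ℝ) ^ (i + 1) := one_div_le_one_div_of_le (by positivity)
          (pow_le_pow_right₀ (by exact_mod_cast (by omega : 1 ≤ m)) (by omega))
      _ ≤ _ := h1.trans (abs_sub_le_dist (coding n m G w) (coding n m G w') 1)

/-- The lower left corner of the approximate square of height `m ^ (-t)` that contains the point
with the code `w`. -/
noncomputable def corner (n m : ℕ) {G : Finset (ℕ × ℕ)} (t : ℕ) (w : ℕ → G) : Plane :=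
  !₂[digitPrefix n (fun x : G => x.1.1) w (columnLevel n m t) / (n : ℝ) ^ columnLevel n m t,
    digitPrefix m (fun x : G => x.1.2) w t / (m : ℝ) ^ t]

theorem dist_coding_corner_le (h : IsCarpetWeight n m G p) (t : ℕ) (w : ℕ → G) :
    dist (coding n m G w) (corner n m t w) ≤ (n + 1) / (m : ℝ) ^ t := by
  have hm := h.three_le
  have hmn := h.le
  have hn0 : (0 : ℝ) < n := by exact_mod_cast (by omega : 0 < n)
  have hm0 : (0 : ℝ) < m := by exact_mod_cast (by omega : 0 < m)
  have key : ∀ {b : ℕ} {d : G → ℕ}, 2 ≤ b → (∀ x, d x < b) → ∀ s : ℕ,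
      |expansion b d w - digitPrefix b d w s / (b : ℝ) ^ s| ≤ 1 / (b : ℝ) ^ s := by
    intro b d hb hd s
    rw [expansion_eq hb hd s, ← sub_div, add_sub_cancel_left, abs_of_nonneg
      (div_nonneg (expansion_nonneg _) (by positivity))]
    exact div_le_div_of_nonneg_right (expansion_le_one hb hd _) (by positivity)
  have h1 := key (by omega : 2 ≤ n) h.fst_lt (columnLevel n m t)
  have h2 := key (by omega : 2 ≤ m) h.snd_lt t
  -- Maximality of `columnLevel`: the width exceeds the height by a factor of at most `n`.
  have h3 : 1 / (n : ℝ) ^ columnLevel n m t ≤ n / (m : ℝ) ^ t := by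
    rw [div_le_div_iff₀ (by positivity) (by positivity), one_mul, ← pow_succ']
    exact_mod_cast (lt_pow_columnLevel (by omega : 1 < n) t).le
  calc _ ≤ _ := dist_le_abs_add_abs _ _
    _ ≤ n / (m : ℝ) ^ t + 1 / (m : ℝ) ^ t := add_le_add (h1.trans h3) h2
    _ = _ := by rw [add_div]

theorem corner_eq_of_agree (h : IsCarpetWeight n m G p) {t : ℕ} {w w' : ℕ → G}
    (hw : Agree (fun x : G => x.1.2) (columnLevel n m t) t w w') :
    corner n m t w = corner n m t w' := by
  rw [corner, corner, (digitPrefix_eq_iff h.snd_lt w w' t).2 hw.2,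
    (digitPrefix_eq_iff h.fst_lt w w' (columnLevel n m t)).2 fun i hi => by rw [hw.1 i hi]]

end IsCarpetWeight

end Coding

/-! ### The upper bound -/

theorem geometricMeanError_le_of_card_le {X : Type*} [PseudoEMetricSpace X] [MeasurableSpace X]
    {μ : Measure X} {k : ℕ} {α : Finset X} (h1 : 1 ≤ α.card) (hk : α.card ≤ k) {c : ℝ}
    (hc : logDistIntegral μ (α : Set X) ≤ (c : EReal)) :
    geometricMeanError μ k ≤ ENNReal.ofReal (Real.exp c) := by
  refine (iInf₂_le α ⟨h1, hk⟩).trans ?_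
  rw [← EReal.exp_coe]
  exact EReal.exp_monotone hc

/-- A function that is constant on sets of large measure has few values. -/
theorem finite_range_of_le_measure {Ω Y : Type*} [MeasurableSpace Ω] (P : Measure Ω)
    [IsProbabilityMeasure P] (f : Ω → Y) (U : Ω → Set Ω) (hU : ∀ w, MeasurableSet (U w))
    (hf : ∀ w, ∀ w' ∈ U w, f w' = f w) {c : ℝ} (hc : 0 < c) (hP : ∀ w, c ≤ P.real (U w)) :
    (Set.range f).Finite ∧ ∀ s : Finset Y, (s : Set Y) ⊆ Set.range f → (s.card : ℝ) ≤ c⁻¹ := by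
  classical
  have key : ∀ s : Finset Y, (s : Set Y) ⊆ Set.range f → (s.card : ℝ) ≤ c⁻¹ := by
    intro s hs
    have := nonempty_of_isProbabilityMeasure P
    choose! g hg using fun y (hy : y ∈ (s : Set Y)) => hs hy
    -- Sets belonging to different values are disjoint, and total mass one leaves room for at most
    -- `c⁻¹` of them.
    have hdisj : (s : Set Y).PairwiseDisjoint fun y => U (g y) := by
      intro y hy z hz hyz
      refine Set.disjoint_left.2 fun w h1 h2 => hyz ?_
      rw [← hg y hy, ← hg z hz, ← hf _ w h1, ← hf _ w h2]
    have h1 := measureReal_biUnion_finset (μ := P) hdisj fun y _ => hU (g y)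
    have h2 : ∑ y ∈ s, c ≤ ∑ y ∈ s, P.real (U (g y)) := Finset.sum_le_sum fun y _ => hP _
    rw [← h1, Finset.sum_const, nsmul_eq_mul] at h2
    rw [← one_div, le_div_iff₀ hc]
    exact h2.trans measureReal_le_one
  refine ⟨?_, key⟩
  by_contra hinf
  obtain ⟨N, hN⟩ := exists_nat_gt c⁻¹
  obtain ⟨t, ht, htc⟩ := Set.Infinite.exists_subset_card_eq hinf N
  have := key t ht
  rw [htc] at this
  linarith

namespace IsCarpetWeight

variable {n m : ℕ} {G : Finset (ℕ × ℕ)} {p : ℕ × ℕ → ℝ}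

theorem fiberInfo_eq (x y : G) (hxy : x.1.2 = y.1.2) :
    fiberInfo (letterMeasure G p) (fun x => x.1.2) x =
      fiberInfo (letterMeasure G p) (fun x => x.1.2) y := by
  simp only [fiberInfo, hxy]

theorem wordMeasure_agree (h : IsCarpetWeight n m G p) (t : ℕ) (w : ℕ → G) :
    wordMeasure (letterMeasure G p)
      {w' | Agree (fun x : G => x.1.2) (columnLevel n m t) t w w'} =
      ENNReal.ofReal (Real.exp (-partialSum (fiberInfo (letterMeasure G p) fun x => x.1.2)
        (condInfo (letterMeasure G p) fun x => x.1.2) (columnLevel n m) t w)) := by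
  have := h.isProbabilityMeasure
  have hm := h.three_le
  have hmn := h.le
  exact BMCarpet.wordMeasure_agree _
    (fun x => by rw [h.real_singleton]; exact h.pos x x.2) _ (columnLevel_le (by omega) hmn t) w

/-- The corners of the stopped squares serve as centres; the distance to a corner is comparable to
`m ^ (-τ)`, whose mean logarithm is known. -/
theorem exists_geometricMeanError_le (h : IsCarpetWeight n m G p) :
    ∃ C : ℝ, 0 < C ∧ ∀ k : ℕ, 1 ≤ k →
      geometricMeanError ((wordMeasure (letterMeasure G p)).map (coding n m G)) k ≤
        ENNReal.ofReal (C * (k : ℝ) ^ (-(1 / dimS n m G p))) := by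
  have := h.isProbabilityMeasure
  obtain ⟨D, η, H, -⟩ := h.exists_isLinearlyGrowing
  obtain ⟨hs, C, hC⟩ := h.exists_abs_sub_dimS_mul_le
  have hm := h.three_le
  have hmn := h.le
  have hlogm : 0 < Real.log m := Real.log_pos (by exact_mod_cast (by omega : 1 < m))
  have hm0 : (0 : ℝ) < m := by exact_mod_cast (by omega : 0 < m)
  set ν := letterMeasure G p
  set r : G → ℕ := fun x => x.1.2 with hr
  set P := wordMeasure ν
  set s := dimS n m G p
  have hne : Nonempty G := nonempty_of_isProbabilityMeasure ν
  have hD : 0 ≤ D := (H.fst_nonneg hne.some).trans (H.fst_le hne.some)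
  have hc : (1 : ℝ) ≤ n + 1 := by linarith [Nat.cast_nonneg (α := ℝ) n]
  have large : ∀ k : ℕ, Real.exp (2 * D) ≤ k → geometricMeanError (P.map (coding n m G)) k ≤
      ENNReal.ofReal (Real.exp (2 * Real.log (n + 1) + (2 * D + C) / s) *
        (k : ℝ) ^ (-(1 / s))) := by
    intro k hk
    have hk0 : (0 : ℝ) < k := (Real.exp_pos _).trans_le hk
    -- With the overshoot `2 * D`, every stopped square has mass at least `1 / k`, so there are at
    -- most `k` corners.
    set L := Real.log k - 2 * D with hL
    have hL0 : 0 ≤ L := sub_nonneg.2 ((Real.le_log_iff_exp_le hk0).2 hk)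
    set τ := firstPassage (fiberInfo ν r) (condInfo ν r) (columnLevel n m) L
    set U : (ℕ → G) → Set (ℕ → G) := fun w => {w' | Agree r (columnLevel n m (τ w)) (τ w) w w'}
    obtain ⟨hfin, hcard⟩ := finite_range_of_le_measure P (fun w => corner n m (τ w) w) U
      (fun w => measurableSet_agree r _ _ w)
      (fun w w' hw => by
        have e : τ w' = τ w := H.firstPassage_eq_of_agree fiberInfo_eq hw
        simp only [e]
        exact (h.corner_eq_of_agree hw).symm)
      (c := (k : ℝ)⁻¹) (by positivity) (fun w => by
        rw [measureReal_def, h.wordMeasure_agree, ENNReal.toReal_ofReal (Real.exp_pos _).le,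
          ← Real.exp_log hk0, ← Real.exp_neg]
        refine Real.exp_le_exp.2 ?_
        have := H.partialSum_firstPassage_le hL0 w
        rw [hL] at this
        linarith)
    set α := hfin.toFinset
    have hα1 : 1 ≤ α.card := Finset.card_pos.2 (hfin.toFinset_nonempty.2 (Set.range_nonempty _))
    have hαk : α.card ≤ k := by
      have := hcard α (by simp [α])
      rw [inv_inv] at this
      exact_mod_cast this
    have hlog := logDistIntegral_map_le (P := P) h.measurable_coding (α := (α : Set Plane))
      ((H.integrable_comp_firstPassage ν L fun k => (k : ℝ)).const_mul (Real.log m))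
      (fun w => mul_nonneg hlogm.le (Nat.cast_nonneg _)) hc fun w =>
        ⟨corner n m (τ w) w, by simp [α], by
          rw [edist_dist]
          refine ENNReal.ofReal_le_ofReal ((h.dist_coding_corner_le _ _).trans_eq ?_)
          rw [div_eq_mul_inv, Real.exp_neg, mul_comm (Real.log m), Real.exp_nat_mul,
            Real.exp_log hm0]⟩
    refine (geometricMeanError_le_of_card_le hα1 hαk hlog).trans (ENNReal.ofReal_le_ofReal ?_)
    rw [Real.rpow_def_of_pos hk0, ← Real.exp_add]
    refine Real.exp_le_exp.2 ?_
    rw [integral_const_mul]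
    have h1 := (abs_le.1 (hC L hL0)).2
    have h2 : (L - C) / s ≤ Real.log m * ∫ w, (τ w : ℝ) ∂P := by
      rw [div_le_iff₀ hs]
      linarith
    have h3 : (L - C) / s = Real.log k * (1 / s) - (2 * D + C) / s := by rw [hL]; ring
    linarith
  -- For `k ≤ exp (2 * D)` one centre is enough: the term `2 * D / s` in the final constant absorbs
  -- the factor `k ^ (1 / s)`.
  have small : ∀ k : ℕ, 1 ≤ k → geometricMeanError (P.map (coding n m G)) k ≤
      ENNReal.ofReal (Real.exp (2 * Real.log (n + 1))) := by
    intro k hk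
    have hlog := logDistIntegral_map_le (P := P) h.measurable_coding
      (α := (({(corner n m 0 (fun _ => hne.some))} : Finset Plane) : Set Plane)) (f := fun _ => 0)
      (integrable_const _) (fun w => le_rfl) hc fun w => ⟨corner n m 0 (fun _ => hne.some), by simp, by
          rw [edist_dist]
          have e : corner n m 0 (fun _ => hne.some) = corner n m 0 w :=
            h.corner_eq_of_agree ⟨fun i hi => absurd hi (by simp [columnLevel_zero]),
              fun i hi => absurd hi (by simp)⟩
          rw [e]
          refine ENNReal.ofReal_le_ofReal ((h.dist_coding_corner_le 0 w).trans_eq ?_)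
          simp⟩
    refine (geometricMeanError_le_of_card_le (by simp) (by simpa using hk) hlog).trans_eq ?_
    simp
  refine ⟨Real.exp (2 * Real.log (n + 1) + (2 * D + |C|) / s), Real.exp_pos _, fun k hk => ?_⟩
  have hk0 : (0 : ℝ) < k := by exact_mod_cast hk
  rcases le_total (Real.exp (2 * D)) k with hk' | hk'
  · refine (large k hk').trans (ENNReal.ofReal_le_ofReal ?_)
    refine mul_le_mul_of_nonneg_right (Real.exp_le_exp.2 ?_) (by positivity)
    have := div_le_div_of_nonneg_right (by linarith [le_abs_self C] : 2 * D + C ≤ 2 * D + |C|) hs.le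
    linarith
  · refine (small k hk).trans (ENNReal.ofReal_le_ofReal ?_)
    rw [Real.rpow_def_of_pos hk0, ← Real.exp_add]
    refine Real.exp_le_exp.2 ?_
    have h1 : Real.log k ≤ 2 * D := (Real.log_le_iff_le_exp hk0).2 hk'
    have h2 : Real.log k / s ≤ (2 * D + |C|) / s :=
      div_le_div_of_nonneg_right (by linarith [abs_nonneg C]) hs.le
    have h3 : Real.log k * -(1 / s) = -(Real.log k / s) := by ring
    linarith

end IsCarpetWeight

/-! ### The lower bound -/

/-- The word after the first passage has the same distribution as the whole word. -/
theorem IsLinearlyGrowing.lintegral_shiftWord_firstPassage {A : Type*} [Fintype A]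
    [MeasurableSpace A] [MeasurableSingletonClass A] {a b : A → ℝ} {ℓ : ℕ → ℕ} {D η : ℝ} {R : ℕ}
    (H : IsLinearlyGrowing a b ℓ D η R) (hℓ : ∀ k, ℓ k ≤ k) (ν : Measure A)
    [IsProbabilityMeasure ν] (L : ℝ) {F : (ℕ → A) → ℝ≥0∞} (hF : Measurable F) :
    ∫⁻ w, F (shiftWord (firstPassage a b ℓ L w) w) ∂wordMeasure ν = ∫⁻ w, F w ∂wordMeasure ν := by
  set τ := firstPassage a b ℓ L
  set P := wordMeasure ν
  have hm : ∀ s, MeasurableSet {w | τ w = s} := fun s =>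
    H.measurable_firstPassage L (measurableSet_singleton s)
  -- For injective `r`, agreement of cells is agreement of the first letters, which shows that the
  -- event of passage at time `s` depends only on the first `s` letters.
  obtain ⟨r, hr⟩ : ∃ r : A → ℕ, Function.Injective r :=
    ⟨fun x => Fintype.equivFin A x, fun x y h => (Fintype.equivFin A).injective (Fin.ext h)⟩
  have hunion : ⋃ s, {w | τ w = s} = Set.univ := by ext; simp
  have hdisj : Pairwise (Function.onFun Disjoint fun s => {w | τ w = s}) := fun i j hij =>
    Set.disjoint_left.2 fun w h1 h2 => hij (h1.symm.trans h2)
  rw [← setLIntegral_univ, ← hunion, lintegral_iUnion hm hdisj]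
  -- Strong Markov property: on each value of the passage time the tail is a fresh word.
  have h1 : ∀ s, ∫⁻ w in {w | τ w = s}, F (shiftWord (τ w) w) ∂P =
      P {w | τ w = s} * ∫⁻ w, F w ∂P := by
    intro s
    rw [← setLIntegral_shiftWord ν s (hm s) ?_ hF]
    · exact setLIntegral_congr_fun (hm s) fun w hw => congrArg (fun t => F (shiftWord t w)) hw
    · intro w w' hw hs
      have hs' : τ w = s := hs
      rw [Set.mem_ofPred_eq, ← hs']
      refine H.firstPassage_eq_of_agree (r := r) (fun x y hxy => by rw [hr hxy]) ?_
      change Agree r (ℓ (τ w)) (τ w) w w'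
      rw [hs']
      exact ⟨fun i hi => hw i (hi.trans_le (hℓ s)), fun i hi => by rw [hw i hi]⟩
  simp only [h1]
  rw [ENNReal.tsum_mul_right, ← measure_iUnion hdisj hm, hunion, measure_univ, one_mul]

theorem logNeg_one : logNeg 1 = 0 := by simp [logNeg]

theorem logNeg_le_of_mul_le {t m : ℕ} (hm : 0 < m) {u v : ℝ} (h : 1 / (m : ℝ) ^ t * u ≤ v) :
    logNeg (ENNReal.ofReal v) ≤
      ENNReal.ofReal (Real.log m * t) + logNeg (ENNReal.ofReal u) := by
  have hm0 : (0 : ℝ) < 1 / (m : ℝ) ^ t := by positivity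
  calc logNeg (ENNReal.ofReal v)
      ≤ logNeg (ENNReal.ofReal (1 / (m : ℝ) ^ t) * ENNReal.ofReal u) := by
        rw [← ENNReal.ofReal_mul hm0.le]
        exact logNeg_anti (ENNReal.ofReal_le_ofReal h)
    _ ≤ _ := logNeg_ofReal_mul_le hm0 _
    _ = _ := by
      rw [one_div, Real.log_inv, neg_neg, Real.log_pow, mul_comm]

namespace IsCarpetWeight

variable {n m : ℕ} {G : Finset (ℕ × ℕ)} {p : ℕ × ℕ → ℝ}

theorem exists_real_le_lt_one (h : IsCarpetWeight n m G p) (d : G → ℕ)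
    (hd : ∀ x, ∃ y, d y ≠ d x) :
    ∃ θ : ℝ, θ < 1 ∧ ∀ x, (letterMeasure G p).real {y | d y = d x} ≤ θ := by
  have := h.isProbabilityMeasure
  have : Nonempty G := nonempty_of_isProbabilityMeasure (letterMeasure G p)
  obtain ⟨x0, hx0⟩ := Finite.exists_max fun x => (letterMeasure G p).real {y | d y = d x}
  obtain ⟨y, hy⟩ := hd x0
  exact ⟨_, h.real_lt_one (y := y) hy, hx0⟩

/-- Over a stopped approximate square, the logarithmic potential of a point of that square. -/
theorem lintegral_indicator_agree_le (h : IsCarpetWeight n m G p) {b : ℕ} {d : G → ℕ}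
    (hb : 2 ≤ b) (hd : ∀ x, d x < b) {B : ℝ}
    (hB : ∀ t : ℝ, ∫⁻ w, logNeg (ENNReal.ofReal |expansion b d w - t|)
      ∂wordMeasure (letterMeasure G p) ≤ ENNReal.ofReal B)
    {D η : ℝ} (H : IsLinearlyGrowing (fiberInfo (letterMeasure G p) fun x => x.1.2)
      (condInfo (letterMeasure G p) fun x => x.1.2) (columnLevel n m) D η n) (L : ℝ)
    (w' : ℕ → G) {t : ℕ} (ht : t = firstPassage (fiberInfo (letterMeasure G p) fun x => x.1.2)
      (condInfo (letterMeasure G p) fun x => x.1.2) (columnLevel n m) L w') {σ : ℕ}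
    (hσ : ∀ w w₁ : ℕ → G, (∀ i < σ, w i = w₁ i) →
      Agree (fun x : G => x.1.2) (columnLevel n m t) t w' w →
        Agree (fun x : G => x.1.2) (columnLevel n m t) t w' w₁) (c : ℝ) :
    Measurable ({w | Agree (fun x : G => x.1.2) (columnLevel n m t) t w' w}.indicator fun w =>
      logNeg (ENNReal.ofReal |expansion b d (shiftWord σ w) - c|)) ∧
    ∫⁻ w, {w | Agree (fun x : G => x.1.2) (columnLevel n m t) t w' w}.indicator (fun w =>
      logNeg (ENNReal.ofReal |expansion b d (shiftWord σ w) - c|)) w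
        ∂wordMeasure (letterMeasure G p) ≤ ENNReal.ofReal (B * Real.exp (-L)) := by
  have := h.isProbabilityMeasure
  have hm := measurable_expansion (A := G) hb hd
  have hF : Measurable fun w : ℕ → G => logNeg (ENNReal.ofReal |expansion b d w - c|) :=
    measurable_logNeg.comp (ENNReal.measurable_ofReal.comp (by fun_prop))
  have hS := measurableSet_agree (fun x : G => x.1.2) (columnLevel n m t) t w'
  refine ⟨(hF.comp (measurable_shiftWord σ)).indicator hS, ?_⟩
  -- By `hσ` the square is an event of the first `σ` letters, so the integral is its mass, at most
  -- `exp (-L)` by stopping, times the potential of an independent tail.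
  rw [lintegral_indicator hS, setLIntegral_shiftWord _ σ hS hσ hF, h.wordMeasure_agree,
    mul_comm B, ENNReal.ofReal_mul (Real.exp_pos _).le]
  refine mul_le_mul' (ENNReal.ofReal_le_ofReal (Real.exp_le_exp.2 (neg_le_neg ?_))) (hB c)
  rw [ht]
  exact (H.lt_partialSum_firstPassage L w').le

/-- The logarithm of the distance of two points of the carpet is bounded from below by that of the
size of the stopped approximate square of the first point, up to a function with a bounded integral
and to a function with a small integral, which depends on the second point. -/
theorem exists_logNeg_dist_le (h : IsCarpetWeight n m G p)
    {D η : ℝ} (H : IsLinearlyGrowing (fiberInfo (letterMeasure G p) fun x => x.1.2)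
      (condInfo (letterMeasure G p) fun x => x.1.2) (columnLevel n m) D η n) :
    ∃ B : ℝ, 0 ≤ B ∧ ∀ L : ℝ, ∃ V : (ℕ → G) → ℝ≥0∞,
      ∫⁻ w, V w ∂wordMeasure (letterMeasure G p) ≤ ENNReal.ofReal B ∧
      ∀ w' : ℕ → G, ∃ Z : (ℕ → G) → ℝ≥0∞, Measurable Z ∧
        ∫⁻ w, Z w ∂wordMeasure (letterMeasure G p) ≤ ENNReal.ofReal (B * Real.exp (-L)) ∧
        ∀ w, logNeg (ENNReal.ofReal (dist (coding n m G w) (coding n m G w'))) ≤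
          ENNReal.ofReal (Real.log m * firstPassage
            (fiberInfo (letterMeasure G p) fun x => x.1.2)
            (condInfo (letterMeasure G p) fun x => x.1.2) (columnLevel n m) L w) + Z w + V w := by
  have := h.isProbabilityMeasure
  have hm := h.three_le
  have hmn := h.le
  have hn0 : (0 : ℝ) < n := by exact_mod_cast (by omega : 0 < n)
  have hm0 : (0 : ℝ) < m := by exact_mod_cast (by omega : 0 < m)
  have hℓ : ∀ k, columnLevel n m k ≤ k := columnLevel_le (by omega) hmn
  set ν := letterMeasure G p
  set r : G → ℕ := fun x => x.1.2 with hr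
  set P := wordMeasure ν
  have hfar : ∀ {t : ℕ} {w w' : ℕ → G}, (∃ i < columnLevel n m t, w i ≠ w' i) →
      logNeg (ENNReal.ofReal (dist (coding n m G w) (coding n m G w'))) ≤
        ENNReal.ofReal (Real.log m * t) := by
    intro t w w' hw
    have := logNeg_le_of_mul_le (t := t) (m := m) (by omega) (u := 1)
      (v := dist (coding n m G w) (coding n m G w'))
      (by rw [mul_one]; exact h.one_div_pow_le_dist_coding hw)
    rwa [ENNReal.ofReal_one, logNeg_one, add_zero] at this
  have hagree : ∀ {L : ℝ} {w w' : ℕ → G},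
      Agree r (columnLevel n m (firstPassage (fiberInfo ν r) (condInfo ν r) (columnLevel n m) L w))
        (firstPassage (fiberInfo ν r) (condInfo ν r) (columnLevel n m) L w) w w' →
      firstPassage (fiberInfo ν r) (condInfo ν r) (columnLevel n m) L w =
        firstPassage (fiberInfo ν r) (condInfo ν r) (columnLevel n m) L w' := fun hw =>
    (H.firstPassage_eq_of_agree fiberInfo_eq hw).symm
  rcases forall_exists_row_or G with hrow | hrow
  · obtain ⟨θ, hθ1, hθ⟩ := h.exists_real_le_lt_one r hrow
    obtain ⟨B, hB0, hB⟩ := exists_lintegral_logNeg_expansion_le ν (by omega : 2 ≤ m) h.snd_lt hθ1 hθ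
    have hem := measurable_expansion (A := G) (by omega : 2 ≤ m) h.snd_lt
    have hFm : ∀ c : ℝ, Measurable fun w : ℕ → G =>
        logNeg (ENNReal.ofReal |expansion m r w - c|) := fun c =>
      measurable_logNeg.comp (ENNReal.measurable_ofReal.comp (by fun_prop))
    -- `V` adds the potentials at `0` and `1`, the two horizontal edges of a rescaled square, hence
    -- the factor two.
    refine ⟨2 * B, by positivity, fun L => ?_⟩
    set τ := firstPassage (fiberInfo ν r) (condInfo ν r) (columnLevel n m) L
    set F : (ℕ → G) → ℝ≥0∞ := fun w => logNeg (ENNReal.ofReal |expansion m r w - 0|) +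
      logNeg (ENNReal.ofReal |expansion m r w - 1|) with hF
    refine ⟨fun w => F (shiftWord (τ w) w), ?_, fun w' => ?_⟩
    · refine (H.lintegral_shiftWord_firstPassage hℓ ν L (F := F)
        ((hFm 0).add (hFm 1))).trans_le ?_
      rw [hF, lintegral_add_left (hFm 0), two_mul, ENNReal.ofReal_add hB0 hB0]
      exact add_le_add (hB 0) (hB 1)
    · obtain ⟨hZm, hZ⟩ := h.lintegral_indicator_agree_le (by omega : 2 ≤ m) h.snd_lt hB H L w'
        (t := τ w') rfl (σ := τ w')
        (fun w w₁ hw hag => ⟨fun i hi => (hag.1 i hi).trans (hw i (hi.trans_le (hℓ _))),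
          fun i hi => by rw [hag.2 i hi, hw i hi]⟩) (expansion m r (shiftWord (τ w') w'))
      refine ⟨_, hZm, hZ.trans (ENNReal.ofReal_le_ofReal ?_), fun w => ?_⟩
      · exact mul_le_mul_of_nonneg_right (by linarith) (Real.exp_pos _).le
      -- Same stopped square: the row expansions differ only in their tails, which is the potential
      -- `Z` centred at the tail of `w'`.
      by_cases hag : Agree r (columnLevel n m (τ w)) (τ w) w w'
      · have e : τ w = τ w' := hagree hag
        rw [e] at hag ⊢
        rw [Set.indicator_of_mem (show w ∈ {w | Agree r _ _ w' w} from hag.symm)]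
        refine le_trans ?_ le_self_add
        refine logNeg_le_of_mul_le (by omega) ?_
        rw [← abs_expansion_sub_eq (by omega) h.snd_lt hag.2]
        exact abs_sub_le_dist (coding n m G w) (coding n m G w') 1
      · by_cases h1 : ∃ i < columnLevel n m (τ w), w i ≠ w' i
        · exact (hfar h1).trans (by rw [add_assoc]; exact le_self_add)
        -- The column prefixes agree but a later row differs. Such squares can touch, and only the
        -- height of the first point above or below the edges of its own square is available.
        · have h2 : ∃ i < τ w, r (w i) ≠ r (w' i) := by
            by_contra h2
            push Not at h1 h2
            exact hag ⟨h1, h2⟩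
          have h3 := min_div_pow_le_abs_expansion_sub (by omega : 2 ≤ m) h.snd_lt h2
          refine (logNeg_le_of_mul_le (by omega) (h3.trans
            (abs_sub_le_dist (coding n m G w) (coding n m G w') 1))).trans ?_
          rw [add_assoc]
          refine add_le_add le_rfl (le_trans ?_ le_add_self)
          have e0 := expansion_nonneg (b := m) (d := r) (shiftWord (τ w) w)
          have e1 := expansion_le_one (by omega : 2 ≤ m) h.snd_lt (shiftWord (τ w) w)
          rcases min_choice (expansion m r (shiftWord (τ w) w))
            (1 - expansion m r (shiftWord (τ w) w)) with hmin | hmin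
          · change logNeg (ENNReal.ofReal (min (expansion m r _) (1 - expansion m r _))) ≤ _
            rw [hmin, hF]
            simp only [sub_zero, abs_of_nonneg e0]
            exact le_self_add
          · change logNeg (ENNReal.ofReal (min (expansion m r _) (1 - expansion m r _))) ≤ _
            rw [hmin, hF]
            simp only
            rw [abs_sub_comm _ (1 : ℝ), abs_of_nonneg (sub_nonneg.2 e1)]
            exact le_add_self
  -- In a single row the vertical coordinate is constant, so the horizontal one is used, with tail
  -- starting at the column level. Squares differing only in later rows do not exist, whence `V =
  -- 0`.
  · have hcol : ∀ x : G, ∃ y : G, y.1.1 ≠ x.1.1 := fun x => by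
      obtain ⟨y, hy⟩ := h.exists_ne x
      exact ⟨y, fun e => hy (Subtype.ext (Prod.ext e (hrow x y)))⟩
    obtain ⟨θ, hθ1, hθ⟩ := h.exists_real_le_lt_one (fun x => x.1.1) hcol
    obtain ⟨B, hB0, hB⟩ := exists_lintegral_logNeg_expansion_le ν (by omega : 2 ≤ n) h.fst_lt hθ1 hθ
    refine ⟨B, hB0, fun L => ⟨fun _ => 0, by simp, fun w' => ?_⟩⟩
    set τ := firstPassage (fiberInfo ν r) (condInfo ν r) (columnLevel n m) L
    obtain ⟨hZm, hZ⟩ := h.lintegral_indicator_agree_le (by omega : 2 ≤ n) h.fst_lt hB H L w'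
      (t := τ w') rfl (σ := columnLevel n m (τ w'))
      (fun w w₁ hw hag => ⟨fun i hi => (hag.1 i hi).trans (hw i hi), fun i hi => hrow _ _⟩)
      (expansion n (fun x : G => x.1.1) (shiftWord (columnLevel n m (τ w')) w'))
    refine ⟨_, hZm, hZ, fun w => ?_⟩
    rw [add_zero]
    by_cases h1 : ∃ i < columnLevel n m (τ w), w i ≠ w' i
    · exact (hfar h1).trans le_self_add
    · push Not at h1
      have hag : Agree r (columnLevel n m (τ w)) (τ w) w w' := ⟨h1, fun i _ => hrow _ _⟩
      have e : τ w = τ w' := hagree hag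
      rw [e] at hag ⊢
      rw [Set.indicator_of_mem (show w ∈ {w | Agree r _ _ w' w} from hag.symm)]
      refine logNeg_le_of_mul_le (by omega) ?_
      calc _ ≤ 1 / (n : ℝ) ^ columnLevel n m (τ w') *
            |expansion n (fun x : G => x.1.1) (shiftWord (columnLevel n m (τ w')) w) -
              expansion n (fun x : G => x.1.1) (shiftWord (columnLevel n m (τ w')) w')| :=
            mul_le_mul_of_nonneg_right
              (one_div_pow_le_one_div_pow_columnLevel (by omega) (by omega) _) (abs_nonneg _)
        _ ≤ _ := by
          rw [← abs_expansion_sub_eq (by omega) h.fst_lt fun i hi => by rw [hag.1 i hi]]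
          exact abs_sub_le_dist (coding n m G w) (coding n m G w') 0

/-- With `L = log k` each centre contributes at most `B / k` through its potential `Z`, so all of
them together cost at most `B`. The edge potential `V` costs another `B`, and `log 2` pays for
moving the centres onto the carpet. -/
theorem exists_le_geometricMeanError (h : IsCarpetWeight n m G p) :
    ∃ C : ℝ, 0 < C ∧ ∀ k : ℕ, 1 ≤ k →
      ENNReal.ofReal (C * (k : ℝ) ^ (-(1 / dimS n m G p))) ≤
        geometricMeanError ((wordMeasure (letterMeasure G p)).map (coding n m G)) k := by
  have := h.isProbabilityMeasure
  obtain ⟨D, η, H, -⟩ := h.exists_isLinearlyGrowing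
  obtain ⟨hs, C, hC⟩ := h.exists_abs_sub_dimS_mul_le
  obtain ⟨B, hB0, hB⟩ := h.exists_logNeg_dist_le H
  have hm := h.three_le
  have hmn := h.le
  have hlogm : 0 < Real.log m := Real.log_pos (by exact_mod_cast (by omega : 1 < m))
  set ν := letterMeasure G p
  set r : G → ℕ := fun x => x.1.2 with hr
  set P := wordMeasure ν
  set s := dimS n m G p
  have hne : Nonempty G := nonempty_of_isProbabilityMeasure ν
  refine ⟨Real.exp (-(Real.log 2 + 2 * B + C / s)), Real.exp_pos _, fun k hk => ?_⟩
  have hk0 : (0 : ℝ) < k := by exact_mod_cast hk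
  set L := Real.log k with hL
  have hL0 : 0 ≤ L := Real.log_nonneg (by exact_mod_cast hk)
  set τ := firstPassage (fiberInfo ν r) (condInfo ν r) (columnLevel n m) L
  set M := Real.log m * ∫ w, (τ w : ℝ) ∂P with hM
  have hM0 : 0 ≤ M := mul_nonneg hlogm.le (integral_nonneg fun w => Nat.cast_nonneg _)
  obtain ⟨V, hV, hVZ⟩ := hB L
  refine le_iInf₂ fun α hα => ?_
  have hcomp : IsCompact (Set.range (coding n m G)) :=
    isCompact_range (continuous_coding (by omega) (by omega) G)
  -- A centre is replaced by a nearest carpet point; by the triangle inequality distances from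
  -- carpet points at most double.
  have hnear : ∀ z : Plane, ∃ w' : ℕ → G, ∀ w : ℕ → G,
      dist (coding n m G w) (coding n m G w') ≤ 2 * dist (coding n m G w) z := by
    intro z
    obtain ⟨_, ⟨w', rfl⟩, hw'⟩ := hcomp.exists_infDist_eq_dist (Set.range_nonempty _) z
    refine ⟨w', fun w => ?_⟩
    have h1 : dist z (coding n m G w') ≤ dist z (coding n m G w) :=
      hw' ▸ Metric.infDist_le_dist_of_mem ⟨w, rfl⟩
    have h2 := dist_triangle (coding n m G w) z (coding n m G w')
    rw [dist_comm z (coding n m G w)] at h1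
    linarith
  choose w' hw' using hnear
  choose Z hZm hZi hZ using hVZ
  have hpoint : ∀ w, logNeg (Metric.infEDist (coding n m G w) (α : Set Plane)) ≤
      ENNReal.ofReal (Real.log 2 + Real.log m * τ w) + ∑ z ∈ α, Z (w' z) w + V w := by
    intro w
    obtain ⟨z, hz, hzd⟩ := α.finite_toSet.isCompact.exists_infEDist_eq_edist
      (Finset.card_pos.1 hα.1) (coding n m G w)
    rw [hzd, edist_dist]
    have h1 : logNeg (ENNReal.ofReal (dist (coding n m G w) z)) ≤ ENNReal.ofReal (Real.log 2) +
        logNeg (ENNReal.ofReal (dist (coding n m G w) (coding n m G (w' z)))) := by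
      have h2 := logNeg_ofReal_mul_le (c := 1 / 2) (by norm_num)
        (ENNReal.ofReal (dist (coding n m G w) (coding n m G (w' z))))
      rw [one_div, Real.log_inv, neg_neg] at h2
      refine (logNeg_anti ?_).trans h2
      rw [← ENNReal.ofReal_mul (by norm_num)]
      exact ENNReal.ofReal_le_ofReal (by linarith [hw' z w])
    refine h1.trans ((add_le_add le_rfl (hZ (w' z) w)).trans ?_)
    rw [← add_assoc, ← add_assoc, ← ENNReal.ofReal_add (Real.log_nonneg (by norm_num))
      (mul_nonneg hlogm.le (Nat.cast_nonneg _))]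
    gcongr
    exact Finset.single_le_sum (f := fun z => Z (w' z) w) (fun _ _ => zero_le) hz
  have hτi : Integrable (fun w => Real.log 2 + Real.log m * τ w) P :=
    (integrable_const _).add ((H.integrable_comp_firstPassage ν L fun k => (k : ℝ)).const_mul _)
  have hτ0 : ∀ w, 0 ≤ Real.log 2 + Real.log m * τ w := fun w =>
    add_nonneg (Real.log_nonneg (by norm_num)) (mul_nonneg hlogm.le (Nat.cast_nonneg _))
  have hτm : Measurable fun w => ENNReal.ofReal (Real.log 2 + Real.log m * τ w) :=
    (measurable_from_nat (f := fun k : ℕ => ENNReal.ofReal (Real.log 2 + Real.log m * k))).comp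
      (H.measurable_firstPassage L)
  have hint : ∫⁻ w, logNeg (Metric.infEDist (coding n m G w) (α : Set Plane)) ∂P ≤
      ENNReal.ofReal (Real.log 2 + M + 2 * B) := by
    have hsumm : Measurable fun w => ∑ z ∈ α, Z (w' z) w :=
      Finset.measurable_sum _ fun z _ => hZm _
    have hfst : Measurable fun w => ENNReal.ofReal (Real.log 2 + Real.log m * τ w) +
        ∑ z ∈ α, Z (w' z) w := hτm.add hsumm
    calc _ ≤ _ := lintegral_mono hpoint
      _ = ∫⁻ w, ENNReal.ofReal (Real.log 2 + Real.log m * τ w) ∂P +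
            ∑ z ∈ α, ∫⁻ w, Z (w' z) w ∂P + ∫⁻ w, V w ∂P := by
          rw [lintegral_add_left hfst, lintegral_add_left hτm,
            lintegral_finsetSum _ fun z _ => hZm _]
      _ ≤ ENNReal.ofReal (Real.log 2 + M) + ENNReal.ofReal B + ENNReal.ofReal B := by
          refine add_le_add (add_le_add (le_of_eq ?_) ?_) hV
          · rw [← ofReal_integral_eq_lintegral_ofReal hτi (ae_of_all _ hτ0), integral_add
              (integrable_const _) ((H.integrable_comp_firstPassage ν L fun k => (k : ℝ)).const_mul _),
              integral_const_mul]
            simp only [hM, integral_const, probReal_univ, one_smul]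
            rfl
          · calc _ ≤ ∑ z ∈ α, ENNReal.ofReal (B * Real.exp (-L)) :=
                  Finset.sum_le_sum fun z _ => hZi _
              _ = ENNReal.ofReal (α.card * (B * Real.exp (-L))) := by
                rw [Finset.sum_const, nsmul_eq_mul, ENNReal.ofReal_mul (Nat.cast_nonneg _),
                  ENNReal.ofReal_natCast]
              _ ≤ _ := by
                refine ENNReal.ofReal_le_ofReal ?_
                rw [Real.exp_neg, hL, Real.exp_log hk0]
                have : (α.card : ℝ) ≤ k := by exact_mod_cast hα.2
                calc (α.card : ℝ) * (B * (k : ℝ)⁻¹) ≤ k * (B * (k : ℝ)⁻¹) := by gcongr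
                  _ = B := by field_simp
      _ = _ := by
          have hl2 : (0 : ℝ) ≤ Real.log 2 := Real.log_nonneg (by norm_num)
          rw [← ENNReal.ofReal_add (by positivity) hB0, ← ENNReal.ofReal_add (by positivity) hB0]
          congr 1
          ring
  have hfin := le_logDistIntegral_map h.measurable_coding (by
    have hl2 : (0 : ℝ) ≤ Real.log 2 := Real.log_nonneg (by norm_num)
    positivity) hint
  refine le_trans ?_ (EReal.exp_monotone hfin)
  rw [EReal.exp_coe, Real.rpow_def_of_pos hk0, ← Real.exp_add]
  refine ENNReal.ofReal_le_ofReal (Real.exp_le_exp.2 ?_)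
  have h1 := (abs_le.1 (hC L hL0)).1
  have h2 : M ≤ (L + C) / s := by
    rw [le_div_iff₀ hs, mul_comm]
    linarith
  have h3 : (L + C) / s = L * (1 / s) + C / s := by ring
  rw [← hL]
  linarith

end IsCarpetWeight

/-! ### The quantization coefficients -/

theorem natCast_rpow_mul_ofReal {k : ℕ} (hk : 1 ≤ k) (t c : ℝ) :
    (k : ℝ≥0∞) ^ t * ENNReal.ofReal (c * (k : ℝ) ^ (-t)) = ENNReal.ofReal c := by
  have hk0 : (0 : ℝ) < k := by exact_mod_cast hk
  rw [← ENNReal.ofReal_natCast, ENNReal.ofReal_rpow_of_pos hk0,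
    ← ENNReal.ofReal_mul (by positivity), mul_left_comm, ← Real.rpow_add hk0, add_neg_cancel,
    Real.rpow_zero, mul_one]

/-- Uniqueness carries the estimates, proved for the image of the Bernoulli measure, over to any
self-affine measure with these weights. -/
theorem IsSelfAffineMeasure.eq_map_coding {n m : ℕ} {G : Finset (ℕ × ℕ)} {p : ℕ × ℕ → ℝ}
    {E : Set Plane} {μ : Measure Plane} (hμ : IsSelfAffineMeasure n m G p E μ)
    (h : IsCarpetWeight n m G p) :
    μ = (wordMeasure (letterMeasure G p)).map (coding n m G) := by
  have := h.isProbabilityMeasure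
  have := hμ.isProbabilityMeasure
  have hm := h.three_le
  have hmn := h.le
  have := Measure.isProbabilityMeasure_map (μ := wordMeasure (letterMeasure G p))
    h.measurable_coding.aemeasurable
  exact eq_of_eq_sum_map_affMap (by omega) (by omega) (fun a ha => (h.pos a ha).le) h.sum_eq
    hμ.eq_sum (map_coding_eq_sum (by omega) (by omega))

end BMCarpet

theorem theorem1p1 (n m : ℕ) (hm : 3 ≤ m) (hmn : m ≤ n)
    (G : Finset (ℕ × ℕ)) (hG : G ⊆ Finset.range n ×ˢ Finset.range m) (hcard : 2 ≤ G.card)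
    (hsep : ∀ a ∈ G, ∀ b ∈ G, a ≠ b →
      2 ≤ max |(a.1 : ℤ) - (b.1 : ℤ)| |(a.2 : ℤ) - (b.2 : ℤ)|)
    (p : ℕ × ℕ → ℝ) (hp : ∀ a ∈ G, 0 < p a) (hsum : ∑ a ∈ G, p a = 1)
    (E : Set BMCarpet.Plane) (μ : Measure BMCarpet.Plane)
    (hμ : BMCarpet.IsSelfAffineMeasure n m G p E μ) :
    (0 < BMCarpet.lowerQuantizationCoeff (BMCarpet.dimS n m G p) μ ∧
      BMCarpet.lowerQuantizationCoeff (BMCarpet.dimS n m G p) μ ≤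
        BMCarpet.upperQuantizationCoeff (BMCarpet.dimS n m G p) μ ∧
      BMCarpet.upperQuantizationCoeff (BMCarpet.dimS n m G p) μ < ∞) ∧
    ∃ c C : ℝ, 0 < c ∧ 0 < C ∧ ∀ k : ℕ, 1 ≤ k →
      ENNReal.ofReal (c * (k : ℝ) ^ (-(1 / BMCarpet.dimS n m G p))) ≤
          BMCarpet.geometricMeanError μ k ∧
        BMCarpet.geometricMeanError μ k ≤
          ENNReal.ofReal (C * (k : ℝ) ^ (-(1 / BMCarpet.dimS n m G p))) := by
  have h : BMCarpet.IsCarpetWeight n m G p := ⟨hm, hmn, hG, hcard, hsep, hp, hsum⟩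
  rw [hμ.eq_map_coding h]
  obtain ⟨c, hc0, hc⟩ := h.exists_le_geometricMeanError
  obtain ⟨C, hC0, hC⟩ := h.exists_geometricMeanError_le
  refine ⟨⟨?_, ?_, ?_⟩, c, C, hc0, hC0, fun k hk => ⟨hc k hk, hC k hk⟩⟩
  · refine (ENNReal.ofReal_pos.2 hc0).trans_le (le_liminf_of_le (by isBoundedDefault) ?_)
    filter_upwards [eventually_ge_atTop 1] with k hk
    rw [← BMCarpet.natCast_rpow_mul_ofReal hk (1 / BMCarpet.dimS n m G p) c]
    exact mul_le_mul_right (hc k hk) _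
  · exact liminf_le_limsup
  · refine lt_of_le_of_lt (limsup_le_of_le (by isBoundedDefault) ?_)
      (ENNReal.ofReal_lt_top (r := C))
    filter_upwards [eventually_ge_atTop 1] with k hk
    rw [← BMCarpet.natCast_rpow_mul_ofReal hk (1 / BMCarpet.dimS n m G p) C]
    exact mul_le_mul_right (hC k hk) _
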